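/- Let $L\ge 2$ be an integer and $1\le\Delta<\infty$. On $\mathcal H_L=(\mathbb C^2)^{\otimes L}$ consider the Hamiltonian of the spin-1/2 ferromagnetic XXZ chain with kink boundary fields (the XXX chain when $\Delta=1$) $$ H_L=\sum_{x=1}^{L-1}\Big[\tfrac14-S^3_xS^3_{x+1}-\Delta^{-1}\big(S^1_xS^1_{x+1}+S^2_xS^2_{x+1}\big)+\tfrac12\sqrt{1-\Delta^{-2}}\,\big(S^3_x-S^3_{x+1}\big)\Big], $$ where $S^1_x,S^2_x,S^3_x$ are the spin-1/2 matrices (half the Pauli matrices) acting on the $x$-th tensor factor. Let $q\in(0,1]$ be the solution of $\Delta=(q+q^{-1})/2$, and let $SU_q(2)$ act on $\mathcal H_L$ through the generators $$ S^3=\sum_{x=1}^L S^3_x,\qquad S^+=\sum_{x=1}^L q^{2\sum_{y<x}S^3_y}\,S^+_x,\qquad S^-=\sum_{x=1}^L q^{-2\sum_{y>x}S^3_y}\,S^-_x, $$ where $S^\pm_x=S^1_x\pm iS^2_x$; these generators commute with $H_L$. For $n=0,1,\dots,\lfloor L/2\rfloor$ let $\mathcal H(L,n)\subseteq\mathcal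 H_L$ be the sum of all irreducible subrepresentations of spin $L/2-n$, i.e. of all irreducible subrepresentations of dimension $L-2n+1$. Then for each such $n$ the minimum $$ \mathcal E(L,n)=\min\{\langle\psi,H_L\psi\rangle:\ \psi\in\mathcal H(L,n),\ \|\psi\|=1\} $$ exists, and $\mathcal E(L,n)$ is strictly increasing in $n$: for all integers $0\le m<n\le\lfloor L/2\rfloor$, $$ \mathcal E(L,m)<\mathcal E(L,n). $$ -/

import Mathlib

/-!
The spin-1/2 XXZ chain with kink boundary fields, its quantum group symmetry, and the minimal
energies in the subspaces of fixed total (quantum group) spin.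

The state space `(ℂ²)^{⊗ L}` is realised in its orthonormal Ising basis: a vector is a function on
the configurations `Fin L → Fin 2`, with `0` for spin up and `1` for spin down.
-/

noncomputable section

namespace XXZ

/-- The state space `(ℂ²)^{⊗ L}` of a chain of `L` spins 1/2, with its Hilbert space structure. -/
abbrev State (L : ℕ) : Type := EuclideanSpace ℂ (Fin L → Fin 2)

/-- Operators on the chain, as matrices in the Ising basis. -/
abbrev Op (L : ℕ) : Type := Matrix (Fin L → Fin 2) (Fin L → Fin 2) ℂ

/-- The spin-1/2 matrix `S¹`. -/
def spin1 : Matrix (Fin 2) (Fin 2) ℂ := !![0, 1 / 2; 1 / 2, 0]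

/-- The spin-1/2 matrix `S²`. -/
def spin2 : Matrix (Fin 2) (Fin 2) ℂ := !![0, -Complex.I / 2; Complex.I / 2, 0]

/-- The spin-1/2 matrix `S³`. -/
def spin3 : Matrix (Fin 2) (Fin 2) ℂ := !![1 / 2, 0; 0, -1 / 2]

/-- The raising matrix `S⁺ = S¹ + i S²`. -/
def spinPlus : Matrix (Fin 2) (Fin 2) ℂ := spin1 + Complex.I • spin2

/-- The lowering matrix `S⁻ = S¹ - i S²`. -/
def spinMinus : Matrix (Fin 2) (Fin 2) ℂ := spin1 - Complex.I • spin2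

/-- The operator `1 ⊗ ⋯ ⊗ A ⊗ ⋯ ⊗ 1` with the matrix `A` acting on the tensor factor `x`. -/
def site {L : ℕ} (x : Fin L) (A : Matrix (Fin 2) (Fin 2) ℂ) : Op L :=
  fun σ τ => if ∀ y, y ≠ x → σ y = τ y then A (σ x) (τ x) else 0

/-- The interaction
`1/4 - S³ₓ S³_y - Δ⁻¹ (S¹ₓ S¹_y + S²ₓ S²_y) + (1/2) √(1 - Δ⁻²) (S³ₓ - S³_y)`
of the sites `x` and `y`. -/
def bond (Δ : ℝ) {L : ℕ} (x y : Fin L) : Op L :=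
  (1 / 4 : ℂ) • (1 : Op L) - site x spin3 * site y spin3
    - ((Δ⁻¹ : ℝ) : ℂ) • (site x spin1 * site y spin1 + site x spin2 * site y spin2)
    + ((1 / 2 * √(1 - (Δ ^ 2)⁻¹) : ℝ) : ℂ) • (site x spin3 - site y spin3)

/-- The Hamiltonian: the sum of the interactions of the `L - 1` pairs of neighbouring sites. -/
def hamiltonian (Δ : ℝ) (L : ℕ) : Op L :=
  ∑ i : Fin (L - 1), bond Δ (⟨i, by omega⟩ : Fin L) (⟨i + 1, by omega⟩ : Fin L)

/-- The deformation parameter `q`: the solution in `(0, 1]` of `Δ = (q + q⁻¹) / 2`. -/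
def qParam (Δ : ℝ) : ℝ := Δ - √(Δ ^ 2 - 1)

theorem qParam_spec {Δ : ℝ} (hΔ : 1 ≤ Δ) :
    0 < qParam Δ ∧ qParam Δ ≤ 1 ∧ (qParam Δ + (qParam Δ)⁻¹) / 2 = Δ := by
  have h0 : (0 : ℝ) ≤ Δ ^ 2 - 1 := by nlinarith
  have hs := Real.sq_sqrt h0
  have hn := Real.sqrt_nonneg (Δ ^ 2 - 1)
  have hpos : 0 < qParam Δ := by
    unfold qParam
    nlinarith
  refine ⟨hpos, ?_, ?_⟩
  · unfold qParam
    nlinarith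
  · have hinv : (qParam Δ)⁻¹ = Δ + √(Δ ^ 2 - 1) := by
      refine inv_eq_of_mul_eq_one_right ?_
      unfold qParam
      nlinarith
    rw [hinv]
    unfold qParam
    ring

/-- The eigenvalue of `2 S³`: `1` for spin up and `-1` for spin down. -/
def twoSz (s : Fin 2) : ℤ := if s = 0 then 1 else -1

/-- The diagonal operator `q ^ (2 k ∑_{y ∈ A} S³_y)`. -/
def qPow (q : ℝ) {L : ℕ} (k : ℤ) (A : Finset (Fin L)) : Op L :=
  Matrix.diagonal fun σ => ((q ^ (k * ∑ y ∈ A, twoSz (σ y)) : ℝ) : ℂ)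

/-- The generator `S³ = ∑ₓ S³ₓ` of the quantum group on the chain. -/
def genS3 (L : ℕ) : Op L := ∑ x : Fin L, site x spin3

/-- The generator `S⁺ = ∑ₓ q ^ (2 ∑_{y < x} S³_y) S⁺ₓ` of the quantum group on the chain. -/
def genPlus (q : ℝ) (L : ℕ) : Op L :=
  ∑ x : Fin L, qPow q 1 (Finset.univ.filter fun y => y < x) * site x spinPlus

/-- The generator `S⁻ = ∑ₓ q ^ (-2 ∑_{y > x} S³_y) S⁻ₓ` of the quantum group on the chain. -/
def genMinus (q : ℝ) (L : ℕ) : Op L :=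
  ∑ x : Fin L, qPow q (-1) (Finset.univ.filter fun y => x < y) * site x spinMinus

/-- The subspace `W` is stable under the action of the quantum group. -/
def IsInvariant (q : ℝ) {L : ℕ} (W : Submodule ℂ (State L)) : Prop :=
  ∀ ψ ∈ W, Matrix.toEuclideanLin (genS3 L) ψ ∈ W ∧
    Matrix.toEuclideanLin (genPlus q L) ψ ∈ W ∧ Matrix.toEuclideanLin (genMinus q L) ψ ∈ W

/-- The subspace `W` is an irreducible subrepresentation of the quantum group. -/
def IsIrreducibleRep (q : ℝ) {L : ℕ} (W : Submodule ℂ (State L)) : Prop :=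
  IsInvariant q W ∧ W ≠ ⊥ ∧ ∀ V : Submodule ℂ (State L), IsInvariant q V → V ≤ W → V = ⊥ ∨ V = W

/-- The sum of all irreducible subrepresentations of spin `j = L/2 - n`, that is, of dimension
`2 j + 1 = L - 2 n + 1`. -/
def spinSector (q : ℝ) (L n : ℕ) : Submodule ℂ (State L) :=
  sSup {W | IsIrreducibleRep q W ∧ Module.finrank ℂ W + 2 * n = L + 1}

/-- The energies `⟨ψ, H ψ⟩` of the unit vectors `ψ` in the sector of total spin `L/2 - n`. -/
def energySet (Δ : ℝ) (L n : ℕ) : Set ℝ :=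
  {e | ∃ ψ ∈ spinSector (qParam Δ) L n, ‖ψ‖ = 1 ∧
    inner ℂ ψ (Matrix.toEuclideanLin (hamiltonian Δ L) ψ) = (e : ℂ)}

/-- The minimal energy in the sector of total spin `L/2 - n`. -/
def minEnergy (Δ : ℝ) (L n : ℕ) : ℝ := sInf (energySet Δ L n)

end XXZ

end

/-!
The interaction of two neighbouring sites is the orthogonal projection onto the `q`-singlet
`↑↓ - q ↓↑`. It factors through the insertion `ins` of a singlet and its adjoint, the contraction
`contr`; these satisfy the Temperley–Lieb relations and commute with the quantum group. With
`d = L - 2 n`, twice the spin, the minimal energy in a sector is the lowest eigenvalue `E(L, d)` of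
the Hamiltonian on the space `highest q L d` of highest weight vectors, because the eigenspaces of
the Hamiltonian are subrepresentations and `lower` is, up to powers of `q ^ (2 S³)`, the adjoint of
`raise` (`IsGround.isotypic`, `spinSector_le`, `mem_spinSector`).

The highest weight vectors are spanned by the `Pattern`s: noncrossing products of singlets and up
spins (`highest_le`). On patterns the interaction acts with nonpositive coefficients, apart from
the arcs that it fixes (`Pattern.contr_cases`). So `c - H` preserves the cone of patterns for large
`c`, and the additional interaction of a chain with an up spin prepended only increases
`(c - H) ^ k` in the order defined by this cone. Comparing growth rates by means of a functional
that is positive on patterns gives `E(L + 1, d + 1) ≤ E(L, d)` (`ground_succ_le`).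

Conversely `H ≥ Ĥ`, where `Ĥ` omits the interaction of the first two sites (`tailHam`). Slicing an
eigenvector of `Ĥ` in `highest q L d` along the first spin gives an eigenvector of the chain of
`L - 1` sites in `highest q (L - 1) (d + 1)` or in `highest q (L - 1) (d - 1)`; by induction on `L`
both have energy at least `E(L - 1, d + 1) ≥ E(L, d + 2)`. Hence `E(L, d) ≥ E(L, d + 2)`. If
equality held, the first interaction would annihilate a ground state, by the Temperley–Lieb
relations all interactions would (`contr_eq_zero_of_eigenvector`), and the state would be
orthogonal to all patterns, hence zero (`ground_lt`).
-/

noncomputable section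

namespace XXZ

open Matrix
open scoped NNReal

/-! ### Insertions and contractions of singlets -/

/-- Wave functions of a chain of `L` spins. -/
abbrev Wave (L : ℕ) : Type := (Fin L → Fin 2) → ℂ

/-- The restriction of a wave function to the configurations whose first spin is `a`. -/
def slice {L : ℕ} (a : Fin 2) : Wave (L + 1) →ₗ[ℂ] Wave L :=
  LinearMap.funLeft ℂ ℂ (vecCons a)

theorem slice_apply {L : ℕ} (a : Fin 2) (f : Wave (L + 1)) (σ : Fin L → Fin 2) :
    slice a f σ = f (vecCons a σ) := rfl

theorem wave_ext {L : ℕ} {f g : Wave (L + 1)} (h : ∀ a, slice a f = slice a g) : f = g := by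
  funext σ
  have := congrFun (h (σ 0)) (vecTail σ)
  rwa [slice_apply, slice_apply, show vecCons (σ 0) (vecTail σ) = σ from cons_head_tail σ] at this

/-- The linear map into wave functions whose slices are the given linear maps. -/
def glue {E : Type*} [AddCommGroup E] [Module ℂ E] {L : ℕ} (T : Fin 2 → E →ₗ[ℂ] Wave L) :
    E →ₗ[ℂ] Wave (L + 1) where
  toFun f σ := T (σ 0) f (vecTail σ)
  map_add' f g := by ext σ; simp
  map_smul' c f := by ext σ; simp

@[simp]
theorem slice_glue {E : Type*} [AddCommGroup E] [Module ℂ E] {L : ℕ}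
    (T : Fin 2 → E →ₗ[ℂ] Wave L) (a : Fin 2) (f : E) : slice a (glue T f) = T a f := by
  ext σ
  simp [slice_apply, glue]

/-- The `q`-singlet `↑↓ - q ↓↑` of two spins. -/
def singlet (q : ℝ) (a b : Fin 2) : ℂ := if a = b then 0 else if a = 0 then 1 else -q

/-- Insertion of a `q`-singlet at the sites `x, x + 1`. It is zero for `x > L`. -/
def ins (q : ℝ) : (x L : ℕ) → Wave L →ₗ[ℂ] Wave (L + 2)
  | 0, _ => glue fun a => glue fun b => singlet q a b • LinearMap.id
  | _ + 1, 0 => 0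
  | x + 1, L + 1 => glue (L := L + 2) fun a => ins q x L ∘ₗ slice a

/-- Contraction of the sites `x, x + 1` with a `q`-singlet. It is zero for `x > L`. -/
def contr (q : ℝ) : (x L : ℕ) → Wave (L + 2) →ₗ[ℂ] Wave L
  | 0, _ => slice 1 ∘ₗ slice 0 - (q : ℂ) • slice 0 ∘ₗ slice 1
  | _ + 1, 0 => 0
  | x + 1, L + 1 => glue fun a => contr q x L ∘ₗ slice (L := L + 2) a

theorem slice_ins_zero (q : ℝ) {L : ℕ} (f : Wave L) (a b : Fin 2) :
    slice b (slice (L := L + 1) a (ins q 0 L f)) = singlet q a b • f := by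
  simp [ins]

theorem slice_ins_succ (q : ℝ) {x L : ℕ} (f : Wave (L + 1)) (a : Fin 2) :
    slice (L := L + 2) a (ins q (x + 1) (L + 1) f) = ins q x L (slice a f) := by
  simp [ins]

theorem contr_zero (q : ℝ) {L : ℕ} (f : Wave (L + 2)) :
    contr q 0 L f = slice 1 (slice (L := L + 1) 0 f) - (q : ℂ) • slice 0 (slice (L := L + 1) 1 f) :=
  rfl

theorem slice_contr_succ (q : ℝ) {x L : ℕ} (f : Wave (L + 1 + 2)) (a : Fin 2) :
    slice a (contr q (x + 1) (L + 1) f) = contr q x L (slice (L := L + 2) a f) := by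
  simp [contr]

theorem contr_ins_self (q : ℝ) {x L : ℕ} (hx : x ≤ L) (f : Wave L) :
    contr q x L (ins q x L f) = (1 + (q : ℂ) ^ 2) • f := by
  induction x generalizing L with
  | zero =>
    simp only [contr_zero, slice_ins_zero, singlet, smul_smul, ← sub_smul]
    congr 1
    simp; ring
  | succ x ih =>
    obtain ⟨L, rfl⟩ : ∃ K, L = K + 1 := ⟨L - 1, by omega⟩
    refine wave_ext fun a => ?_
    rw [slice_contr_succ, slice_ins_succ, ih (by omega), map_smul]

theorem contr_ins_succ (q : ℝ) {x L : ℕ} (hx : x + 1 ≤ L) (f : Wave L) :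
    contr q x L (ins q (x + 1) L f) = -(q : ℂ) • f := by
  induction x generalizing L with
  | zero =>
    obtain ⟨L, rfl⟩ : ∃ K, L = K + 1 := ⟨L - 1, by omega⟩
    refine wave_ext fun a => ?_
    rw [contr_zero, slice_ins_succ, slice_ins_succ, map_sub, map_smul, slice_ins_zero,
      slice_ins_zero, map_smul]
    fin_cases a <;> simp [singlet]
  | succ x ih =>
    obtain ⟨L, rfl⟩ : ∃ K, L = K + 1 := ⟨L - 1, by omega⟩
    refine wave_ext fun a => ?_
    rw [slice_contr_succ, slice_ins_succ, ih (by omega), map_smul]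

theorem contr_succ_ins (q : ℝ) {x L : ℕ} (hx : x + 1 ≤ L) (f : Wave L) :
    contr q (x + 1) L (ins q x L f) = -(q : ℂ) • f := by
  induction x generalizing L with
  | zero =>
    obtain ⟨L, rfl⟩ : ∃ K, L = K + 1 := ⟨L - 1, by omega⟩
    refine wave_ext fun a => ?_
    rw [slice_contr_succ, contr_zero, slice_ins_zero, slice_ins_zero, map_smul, map_smul, map_smul]
    fin_cases a <;> simp [singlet]
  | succ x ih =>
    obtain ⟨L, rfl⟩ : ∃ K, L = K + 1 := ⟨L - 1, by omega⟩
    refine wave_ext fun a => ?_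
    rw [slice_contr_succ, slice_ins_succ, ih (by omega), map_smul]

theorem ins_of_lt (q : ℝ) {x L : ℕ} (hx : L < x) (f : Wave L) : ins q x L f = 0 := by
  induction L generalizing x with
  | zero =>
    obtain ⟨x, rfl⟩ : ∃ K, x = K + 1 := ⟨x - 1, by omega⟩
    rfl
  | succ L ih =>
    obtain ⟨x, rfl⟩ : ∃ K, x = K + 1 := ⟨x - 1, by omega⟩
    refine wave_ext fun a => ?_
    rw [slice_ins_succ, ih (by omega), map_zero]

theorem contr_of_lt (q : ℝ) {x L : ℕ} (hx : L < x) (f : Wave (L + 2)) : contr q x L f = 0 := by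
  induction L generalizing x with
  | zero =>
    obtain ⟨x, rfl⟩ : ∃ K, x = K + 1 := ⟨x - 1, by omega⟩
    rfl
  | succ L ih =>
    obtain ⟨x, rfl⟩ : ∃ K, x = K + 1 := ⟨x - 1, by omega⟩
    refine wave_ext fun a => ?_
    rw [slice_contr_succ, ih (by omega), map_zero]

theorem contr_ins_add_two (q : ℝ) {x y L : ℕ} (hxy : x ≤ y) (f : Wave (L + 2)) :
    contr q x (L + 2) (ins q (y + 2) (L + 2) f) = ins q y L (contr q x L f) := by
  induction x generalizing y L with
  | zero =>
    simp only [contr_zero, map_sub, map_smul]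
    rw [slice_ins_succ (L := L + 1), slice_ins_succ (L := L + 1), slice_ins_succ, slice_ins_succ]
  | succ x ih =>
    obtain ⟨y, rfl⟩ : ∃ K, y = K + 1 := ⟨y - 1, by omega⟩
    cases L with
    | zero => rw [ins_of_lt q (by omega), map_zero, ins_of_lt q (by omega)]
    | succ L =>
      refine wave_ext fun a => ?_
      rw [slice_contr_succ (L := L + 2), slice_ins_succ (L := L + 2), ih (by omega),
        slice_ins_succ, slice_contr_succ]

theorem contr_add_two_ins (q : ℝ) {x y L : ℕ} (hxy : x ≤ y) (f : Wave (L + 2)) :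
    contr q (y + 2) (L + 2) (ins q x (L + 2) f) = ins q x L (contr q y L f) := by
  induction x generalizing y L with
  | zero =>
    refine wave_ext fun a => wave_ext fun b => ?_
    rw [slice_contr_succ (L := L + 1), slice_contr_succ, slice_ins_zero, slice_ins_zero, map_smul]
  | succ x ih =>
    obtain ⟨y, rfl⟩ : ∃ K, y = K + 1 := ⟨y - 1, by omega⟩
    cases L with
    | zero => rw [contr_of_lt q (by omega), contr_of_lt q (by omega), map_zero]
    | succ L =>
      refine wave_ext fun a => ?_
      rw [slice_contr_succ (L := L + 2), slice_ins_succ (L := L + 2), ih (by omega),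
        slice_ins_succ, slice_contr_succ]

theorem ins_ins (q : ℝ) {x y L : ℕ} (hxy : x ≤ y) (f : Wave L) :
    ins q x (L + 2) (ins q y L f) = ins q (y + 2) (L + 2) (ins q x L f) := by
  induction x generalizing y L with
  | zero =>
    refine wave_ext fun a => wave_ext fun b => ?_
    rw [slice_ins_zero, slice_ins_succ (L := L + 1), slice_ins_succ, slice_ins_zero, map_smul]
  | succ x ih =>
    obtain ⟨y, rfl⟩ : ∃ K, y = K + 1 := ⟨y - 1, by omega⟩
    cases L with
    | zero => rw [ins_of_lt q (x := y + 1) (by omega), map_zero, ins_of_lt q (by omega)]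
    | succ L =>
      refine wave_ext fun a => ?_
      rw [slice_ins_succ (L := L + 2), slice_ins_succ (L := L + 2), slice_ins_succ,
        slice_ins_succ, ih (by omega)]

theorem contr_contr (q : ℝ) {x y L : ℕ} (hxy : x ≤ y) (f : Wave (L + 2 + 2)) :
    contr q x L (contr q (y + 2) (L + 2) f) = contr q y L (contr q x (L + 2) f) := by
  induction x generalizing y L with
  | zero =>
    simp only [contr_zero, map_sub, map_smul]
    rw [slice_contr_succ (L := L + 1), slice_contr_succ (L := L + 1), slice_contr_succ,
      slice_contr_succ]
  | succ x ih =>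
    obtain ⟨y, rfl⟩ : ∃ K, y = K + 1 := ⟨y - 1, by omega⟩
    cases L with
    | zero => rw [contr_of_lt q (x := y + 1 + 2) (by omega), map_zero, contr_of_lt q (by omega)]
    | succ L =>
      refine wave_ext fun a => ?_
      rw [slice_contr_succ, slice_contr_succ (L := L + 2), slice_contr_succ,
        slice_contr_succ (L := L + 2), ih (by omega)]

/-! ### Inner products of wave functions -/

theorem inner_succ {L : ℕ} (f g : Wave (L + 1)) :
    star f ⬝ᵥ g = star (slice 0 f) ⬝ᵥ slice 0 g + star (slice 1 f) ⬝ᵥ slice 1 g := by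
  simp only [dotProduct, slice_apply, Pi.star_apply]
  rw [← (Fin.consEquiv fun _ : Fin (L + 1) => Fin 2).sum_comp, Fintype.sum_prod_type,
    Fin.sum_univ_two]
  rfl

theorem inner_ins (q : ℝ) {x L : ℕ} (f : Wave L) (g : Wave (L + 2)) :
    star (ins q x L f) ⬝ᵥ g = star f ⬝ᵥ contr q x L g := by
  induction x generalizing L with
  | zero =>
    rw [inner_succ (L := L + 1), inner_succ, inner_succ, contr_zero]
    simp only [slice_ins_zero]
    simp [singlet, sub_eq_add_neg]
  | succ x ih =>
    cases L with
    | zero => simp [ins, contr]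
    | succ L =>
      rw [inner_succ (L := L + 2), inner_succ (L := L)]
      simp only [slice_ins_succ, slice_contr_succ, ih]

open scoped ComplexOrder in
theorem inner_self_eq_zero_iff {L : ℕ} {f : Wave L} : star f ⬝ᵥ f = 0 ↔ f = 0 :=
  dotProduct_star_self_eq_zero

/-! ### The generators and the Hamiltonian, one site at a time -/

theorem site_mulVec {L : ℕ} (x : Fin L) (A : Matrix (Fin 2) (Fin 2) ℂ) (f : Wave L)
    (σ : Fin L → Fin 2) :
    (site x A *ᵥ f) σ = ∑ t, A (σ x) t * f (Function.update σ x t) := by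
  classical
  rw [mulVec, dotProduct]
  symm
  refine Finset.sum_of_injOn (fun t => Function.update σ x t) ?_ (by simp) ?_ ?_
  · intro s _ t _ h
    simpa using congrFun h x
  · intro τ _ hτ
    have : ¬ ∀ y, y ≠ x → σ y = τ y := by
      intro h
      refine hτ ⟨τ x, by simp, ?_⟩
      funext y
      by_cases hy : y = x
      · subst hy; simp
      · simp [hy, h y hy]
    simp [site, this]
  · intro t _
    have : ∀ y, y ≠ x → σ y = Function.update σ x t y := fun y hy => by simp [hy]
    simp only [site, if_pos this, Function.update_self]

theorem slice_site_zero {L : ℕ} (A : Matrix (Fin 2) (Fin 2) ℂ) (f : Wave (L + 1)) (a : Fin 2) :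
    slice a (site 0 A *ᵥ f) = A a 0 • slice 0 f + A a 1 • slice 1 f := by
  funext σ
  have h (t : Fin 2) : Function.update (vecCons a σ) 0 t = vecCons t σ := Fin.update_cons_zero ..
  simp [slice_apply, site_mulVec, Fin.sum_univ_two, h]

theorem slice_site_succ {L : ℕ} (x : Fin L) (A : Matrix (Fin 2) (Fin 2) ℂ) (f : Wave (L + 1))
    (a : Fin 2) : slice a (site x.succ A *ᵥ f) = site x A *ᵥ slice a f := by
  funext σ
  have h (t : Fin 2) : Function.update (vecCons a σ) x.succ t =
    vecCons a (Function.update σ x t) := (Fin.cons_update ..).symm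
  simp [slice_apply, site_mulVec, h]

/-- The generator `S³` as a linear map. -/
def spinZ (L : ℕ) : Wave L →ₗ[ℂ] Wave L := (genS3 L).mulVecLin

/-- The generator `S⁺` as a linear map. -/
def raise (q : ℝ) (L : ℕ) : Wave L →ₗ[ℂ] Wave L := (genPlus q L).mulVecLin

/-- The generator `S⁻` as a linear map. -/
def lower (q : ℝ) (L : ℕ) : Wave L →ₗ[ℂ] Wave L := (genMinus q L).mulVecLin

/-- The operator `q ^ (2 k S³)` as a linear map. -/
def weightPow (q : ℝ) (k : ℤ) (L : ℕ) : Wave L →ₗ[ℂ] Wave L :=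
  (qPow q k (Finset.univ : Finset (Fin L))).mulVecLin

/-- The Hamiltonian as a linear map. -/
def ham (Δ : ℝ) (L : ℕ) : Wave L →ₗ[ℂ] Wave L := (hamiltonian Δ L).mulVecLin

theorem spinZ_apply {L : ℕ} (f : Wave L) : spinZ L f = genS3 L *ᵥ f := rfl

theorem raise_apply {q : ℝ} {L : ℕ} (f : Wave L) : raise q L f = genPlus q L *ᵥ f := rfl

theorem lower_apply {q : ℝ} {L : ℕ} (f : Wave L) : lower q L f = genMinus q L *ᵥ f := rfl

theorem weightPow_apply {q : ℝ} {k : ℤ} {L : ℕ} (f : Wave L) :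
    weightPow q k L f = qPow q k Finset.univ *ᵥ f := rfl

theorem ham_apply {Δ : ℝ} {L : ℕ} (f : Wave L) : ham Δ L f = hamiltonian Δ L *ᵥ f := rfl

theorem spinPlus_eq : spinPlus = !![0, 1; 0, 0] := by
  ext i j
  fin_cases i <;> fin_cases j <;> simp [spinPlus, spin1, spin2]
  · linear_combination (-1 / 2) * Complex.I_mul_I
  · linear_combination (1 / 2) * Complex.I_mul_I

theorem spinMinus_eq : spinMinus = !![0, 0; 1, 0] := by
  ext i j
  fin_cases i <;> fin_cases j <;> simp [spinMinus, spin1, spin2]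
  · linear_combination (1 / 2) * Complex.I_mul_I
  · linear_combination (-1 / 2) * Complex.I_mul_I

theorem qPow_mulVec (q : ℝ) {L : ℕ} (k : ℤ) (A : Finset (Fin L)) (f : Wave L)
    (σ : Fin L → Fin 2) :
    (qPow q k A *ᵥ f) σ = ((q ^ (k * ∑ y ∈ A, twoSz (σ y)) : ℝ) : ℂ) * f σ := by
  rw [qPow, mulVec_diagonal]

theorem slice_spinZ {L : ℕ} (f : Wave (L + 1)) (a : Fin 2) :
    slice a (spinZ (L + 1) f) = ((twoSz a : ℂ) / 2) • slice a f + spinZ L (slice a f) := by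
  simp only [spinZ_apply, genS3, sum_mulVec]
  rw [Fin.sum_univ_succ, map_add, map_sum]
  simp only [slice_site_succ]
  congr 1
  fin_cases a <;> simp only [Fin.zero_eta, Fin.mk_one, slice_site_zero] <;> simp [spin3, twoSz]

theorem slice_weightPow {q : ℝ} (hq : 0 < q) (k : ℤ) {L : ℕ} (f : Wave (L + 1)) (a : Fin 2) :
    slice a (weightPow q k (L + 1) f) =
      ((q ^ (k * twoSz a) : ℝ) : ℂ) • weightPow q k L (slice a f) := by
  funext σ
  simp only [weightPow_apply, slice_apply, qPow_mulVec, Pi.smul_apply, smul_eq_mul,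
    Fin.sum_univ_succ, cons_val_zero, cons_val_succ, mul_add, zpow_add₀ hq.ne']
  push_cast
  ring

theorem slice_raise {q : ℝ} (hq : 0 < q) {L : ℕ} (f : Wave (L + 1)) (a : Fin 2) :
    slice a (raise q (L + 1) f) =
      (if a = 0 then slice 1 f else 0) + ((q ^ twoSz a : ℝ) : ℂ) • raise q L (slice a f) := by
  simp only [raise_apply, genPlus, sum_mulVec, ← mulVec_mulVec]
  rw [Fin.sum_univ_succ, map_add, map_sum, Finset.smul_sum]
  congr 1
  · funext σ
    have h : slice a (site 0 spinPlus *ᵥ f) = if a = 0 then slice 1 f else 0 := by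
      rw [slice_site_zero]
      fin_cases a <;> simp [spinPlus_eq]
    rw [slice_apply, qPow_mulVec, show (site 0 _ *ᵥ f) (vecCons a σ) = _ from congrFun h σ]
    simp
  · refine Finset.sum_congr rfl fun x _ => ?_
    funext σ
    rw [slice_apply, qPow_mulVec, show (site x.succ _ *ᵥ f) (vecCons a σ) = _ from
      congrFun (slice_site_succ x _ f a) σ, Pi.smul_apply, qPow_mulVec,
      smul_eq_mul, ← mul_assoc]
    congr 1
    rw [← Complex.ofReal_mul, ← zpow_add₀ hq.ne']
    congr 2
    simp [Finset.sum_filter, Fin.sum_univ_succ]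

theorem slice_lower {q : ℝ} {L : ℕ} (f : Wave (L + 1)) (a : Fin 2) :
    slice a (lower q (L + 1) f) =
      (if a = 1 then weightPow q (-1) L (slice 0 f) else 0) + lower q L (slice a f) := by
  simp only [lower_apply, genMinus, sum_mulVec, ← mulVec_mulVec]
  rw [Fin.sum_univ_succ, map_add, map_sum]
  congr 1
  · funext σ
    have h : slice a (site 0 spinMinus *ᵥ f) = if a = 1 then slice 0 f else 0 := by
      rw [slice_site_zero]
      fin_cases a <;> simp [spinMinus_eq]
    rw [slice_apply, qPow_mulVec, show (site 0 _ *ᵥ f) (vecCons a σ) = _ from congrFun h σ]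
    split_ifs
    · simp [weightPow_apply, qPow_mulVec, Finset.sum_filter, Fin.sum_univ_succ]
    · simp
  · refine Finset.sum_congr rfl fun x _ => ?_
    funext σ
    rw [slice_apply, qPow_mulVec, show (site x.succ _ *ᵥ f) (vecCons a σ) = _ from
      congrFun (slice_site_succ x _ f a) σ, qPow_mulVec]
    simp [Finset.sum_filter, Fin.sum_univ_succ]

/-! ### The interaction is the projection onto the `q`-singlet -/

theorem slice_bond_succ (Δ : ℝ) {L : ℕ} (x y : Fin L) (f : Wave (L + 1)) (a : Fin 2) :
    slice a (bond Δ x.succ y.succ *ᵥ f) = bond Δ x y *ᵥ slice a f := by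
  simp only [bond, sub_mulVec, add_mulVec, smul_mulVec, ← mulVec_mulVec, one_mulVec, map_add,
    map_sub, map_smul, slice_site_succ]

theorem inv_eq_qParam {Δ : ℝ} (hΔ : 1 ≤ Δ) : Δ⁻¹ = 2 * qParam Δ / (1 + qParam Δ ^ 2) := by
  obtain ⟨h0, _, h2⟩ := qParam_spec hΔ
  set q := qParam Δ
  rw [← h2]
  field_simp
  ring

theorem sqrt_eq_qParam {Δ : ℝ} (hΔ : 1 ≤ Δ) :
    √(1 - (Δ ^ 2)⁻¹) = (1 - qParam Δ ^ 2) / (1 + qParam Δ ^ 2) := by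
  have hi := inv_eq_qParam hΔ
  obtain ⟨h0, h1, h2⟩ := qParam_spec hΔ
  set q := qParam Δ
  rw [← inv_pow, hi, show 1 - (2 * q / (1 + q ^ 2)) ^ 2 = ((1 - q ^ 2) / (1 + q ^ 2)) ^ 2 by
    field_simp; ring]
  refine Real.sqrt_sq (div_nonneg ?_ (by positivity))
  nlinarith

theorem bond_zero_one {Δ : ℝ} (hΔ : 1 ≤ Δ) {L : ℕ} (f : Wave (L + 2)) :
    bond Δ 0 1 *ᵥ f =
      ((1 + (qParam Δ : ℂ) ^ 2)⁻¹) • ins (qParam Δ) 0 L (contr (qParam Δ) 0 L f) := by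
  obtain ⟨h0, -, -⟩ := qParam_spec hΔ
  have hi := inv_eq_qParam hΔ
  have hs := sqrt_eq_qParam hΔ
  have hne : (1 + (qParam Δ : ℂ) ^ 2) ≠ 0 := by
    have : (0 : ℝ) < 1 + qParam Δ ^ 2 := by positivity
    exact_mod_cast this.ne'
  have h1 (A : Matrix (Fin 2) (Fin 2) ℂ) (g : Wave (L + 2)) (a : Fin 2) :
      slice (L := L + 1) a (site 1 A *ᵥ g) = site 0 A *ᵥ slice (L := L + 1) a g :=
    slice_site_succ (L := L + 1) 0 A g a
  refine wave_ext fun a => wave_ext fun b => ?_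
  rw [map_smul, map_smul, slice_ins_zero, contr_zero]
  simp only [bond, sub_mulVec, add_mulVec, smul_mulVec, ← mulVec_mulVec, one_mulVec, map_add,
    map_sub, map_smul, slice_site_zero, h1, hi, hs]
  set q := qParam Δ
  fin_cases a <;> fin_cases b <;> funext σ <;>
    simp [spin1, spin2, spin3, singlet] <;> field_simp <;> ring_nf <;> simp <;> ring_nf

theorem hamiltonian_succ (Δ : ℝ) {L : ℕ} (f : Wave (L + 2)) (a : Fin 2) :
    slice (L := L + 1) a (ham Δ (L + 2) f) =
      slice (L := L + 1) a (bond Δ 0 1 *ᵥ f) + ham Δ (L + 1) (slice (L := L + 1) a f) := by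
  simp only [ham_apply, hamiltonian, sum_mulVec, map_sum]
  refine (Fin.sum_univ_succ (n := L) _).trans ?_
  congr 1
  refine Finset.sum_congr rfl fun x _ => ?_
  exact slice_bond_succ Δ (L := L + 1) ⟨x, by omega⟩ ⟨x + 1, by omega⟩ f a

/-- The interaction of the sites `x, x + 1`, as the projection onto the `q`-singlet. -/
def singletProj (q : ℝ) (x L : ℕ) : Wave (L + 2) →ₗ[ℂ] Wave (L + 2) :=
  (1 + (q : ℂ) ^ 2)⁻¹ • ins q x L ∘ₗ contr q x L

theorem singletProj_apply (q : ℝ) {x L : ℕ} (f : Wave (L + 2)) :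
    singletProj q x L f = (1 + (q : ℂ) ^ 2)⁻¹ • ins q x L (contr q x L f) := rfl

theorem slice_singletProj_succ (q : ℝ) {x L : ℕ} (f : Wave (L + 1 + 2)) (a : Fin 2) :
    slice (L := L + 2) a (singletProj q (x + 1) (L + 1) f) =
      singletProj q x L (slice (L := L + 2) a f) := by
  simp only [singletProj_apply, map_smul, slice_ins_succ, slice_contr_succ]

theorem ham_one (Δ : ℝ) (f : Wave 1) : ham Δ 1 f = 0 := by
  simp [ham_apply, hamiltonian]

theorem ham_zero (Δ : ℝ) (f : Wave 0) : ham Δ 0 f = 0 := by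
  simp [ham_apply, hamiltonian]

/-- The recursion of the Hamiltonian in the number of sites. -/
theorem slice_ham {Δ : ℝ} (hΔ : 1 ≤ Δ) {L : ℕ} (f : Wave (L + 2)) (a : Fin 2) :
    slice (L := L + 1) a (ham Δ (L + 2) f) =
      slice (L := L + 1) a (singletProj (qParam Δ) 0 L f) +
        ham Δ (L + 1) (slice (L := L + 1) a f) := by
  rw [hamiltonian_succ, bond_zero_one hΔ, singletProj_apply]

theorem ham_eq_sum {Δ : ℝ} (hΔ : 1 ≤ Δ) {L : ℕ} (f : Wave (L + 2)) :
    ham Δ (L + 2) f = ∑ x ∈ Finset.range (L + 1), singletProj (qParam Δ) x L f := by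
  induction L with
  | zero =>
    refine wave_ext fun a => ?_
    rw [slice_ham hΔ, ham_one]
    simp
  | succ L ih =>
    refine wave_ext fun a => ?_
    rw [slice_ham hΔ, Finset.sum_range_succ', map_add, map_sum]
    simp only [slice_singletProj_succ]
    rw [← ih]
    exact add_comm _ _

/-! ### Symmetries of the singlet insertions and contractions -/

theorem singlet_self (q : ℝ) (a : Fin 2) : singlet q a a = 0 := by simp [singlet]

@[simp] theorem singlet_zero_one (q : ℝ) : singlet q 0 1 = 1 := by simp [singlet]

@[simp] theorem singlet_one_zero (q : ℝ) : singlet q 1 0 = -q := by simp [singlet]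

@[simp] theorem twoSz_zero : twoSz 0 = 1 := rfl

@[simp] theorem twoSz_one : twoSz 1 = -1 := rfl

theorem spinZ_ins (q : ℝ) {x L : ℕ} (f : Wave L) :
    spinZ (L + 2) (ins q x L f) = ins q x L (spinZ L f) := by
  induction x generalizing L with
  | zero =>
    refine wave_ext fun a => wave_ext fun b => ?_
    simp only [slice_spinZ (L := L + 1), slice_spinZ, map_add, map_smul, slice_ins_zero]
    fin_cases a <;> fin_cases b <;> simp [singlet_self] <;> module
  | succ x ih =>
    cases L with
    | zero => simp only [ins_of_lt q (x := x + 1) (L := 0) (by omega), map_zero]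
    | succ L =>
      refine wave_ext fun a => ?_
      rw [slice_spinZ (L := L + 2), slice_ins_succ, slice_ins_succ, ih, slice_spinZ, map_add,
        map_smul]

theorem raise_ins {q : ℝ} (hq : 0 < q) {x L : ℕ} (f : Wave L) :
    raise q (L + 2) (ins q x L f) = ins q x L (raise q L f) := by
  induction x generalizing L with
  | zero =>
    have hq' : (q : ℂ) ≠ 0 := by exact_mod_cast hq.ne'
    refine wave_ext fun a => wave_ext fun b => ?_
    simp only [slice_raise hq (L := L + 1), slice_raise hq, map_add, map_smul, slice_ins_zero,
      apply_ite (slice b), map_zero]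
    fin_cases a <;> fin_cases b <;> simp [singlet_self, smul_smul, -Complex.coe_smul, hq']
  | succ x ih =>
    cases L with
    | zero => simp only [ins_of_lt q (x := x + 1) (L := 0) (by omega), map_zero]
    | succ L =>
      refine wave_ext fun a => ?_
      rw [slice_raise hq (L := L + 2), slice_ins_succ, slice_ins_succ, slice_ins_succ, ih,
        slice_raise hq, map_add, map_smul, apply_ite (ins q x L), map_zero]

theorem weightPow_ins {q : ℝ} (hq : 0 < q) (k : ℤ) {x L : ℕ} (f : Wave L) :
    weightPow q k (L + 2) (ins q x L f) = ins q x L (weightPow q k L f) := by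
  induction x generalizing L with
  | zero =>
    have hq' : (q : ℂ) ≠ 0 := by exact_mod_cast hq.ne'
    refine wave_ext fun a => wave_ext fun b => ?_
    simp only [slice_weightPow hq (L := L + 1), slice_weightPow hq, map_smul, slice_ins_zero]
    fin_cases a <;> fin_cases b <;>
      simp [singlet_self, smul_smul, -Complex.coe_smul, hq', zpow_ne_zero]
  | succ x ih =>
    cases L with
    | zero => simp only [ins_of_lt q (x := x + 1) (L := 0) (by omega), map_zero]
    | succ L =>
      refine wave_ext fun a => ?_
      rw [slice_weightPow hq (L := L + 2), slice_ins_succ, slice_ins_succ, ih,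
        slice_weightPow hq, map_smul]

theorem lower_ins {q : ℝ} (hq : 0 < q) {x L : ℕ} (f : Wave L) :
    lower q (L + 2) (ins q x L f) = ins q x L (lower q L f) := by
  induction x generalizing L with
  | zero =>
    have hq' : (q : ℂ) ≠ 0 := by exact_mod_cast hq.ne'
    refine wave_ext fun a => wave_ext fun b => ?_
    simp only [slice_lower (L := L + 1), slice_lower, map_add, map_smul, slice_ins_zero,
      apply_ite (slice b), map_zero, slice_weightPow hq]
    fin_cases a <;> fin_cases b <;> simp [singlet_self, -Complex.coe_smul]
  | succ x ih =>
    cases L with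
    | zero => simp only [ins_of_lt q (x := x + 1) (L := 0) (by omega), map_zero]
    | succ L =>
      refine wave_ext fun a => ?_
      rw [slice_lower (L := L + 2), slice_ins_succ, slice_ins_succ, slice_ins_succ, ih,
        slice_lower, map_add, apply_ite (ins q x L), map_zero, weightPow_ins hq]

theorem spinZ_contr (q : ℝ) {x L : ℕ} (f : Wave (L + 2)) :
    spinZ L (contr q x L f) = contr q x L (spinZ (L + 2) f) := by
  induction x generalizing L with
  | zero =>
    simp only [contr_zero, slice_spinZ (L := L + 1), slice_spinZ, map_sub, map_add, map_smul]
    simp [smul_smul]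
    module
  | succ x ih =>
    cases L with
    | zero => simp only [contr_of_lt q (x := x + 1) (L := 0) (by omega), map_zero]
    | succ L =>
      refine wave_ext fun a => ?_
      rw [slice_spinZ, slice_contr_succ, slice_contr_succ, ih, slice_spinZ (L := L + 2), map_add,
        map_smul]

theorem raise_contr {q : ℝ} (hq : 0 < q) {x L : ℕ} (f : Wave (L + 2)) :
    raise q L (contr q x L f) = contr q x L (raise q (L + 2) f) := by
  induction x generalizing L with
  | zero =>
    have hq' : (q : ℂ) ≠ 0 := by exact_mod_cast hq.ne'
    simp only [contr_zero, slice_raise hq (L := L + 1), slice_raise hq, map_sub, map_add, map_smul]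
    simp [smul_smul, -Complex.coe_smul, hq']
  | succ x ih =>
    cases L with
    | zero => simp only [contr_of_lt q (x := x + 1) (L := 0) (by omega), map_zero]
    | succ L =>
      refine wave_ext fun a => ?_
      rw [slice_raise hq, slice_contr_succ, slice_contr_succ, slice_contr_succ, ih,
        slice_raise hq (L := L + 2), map_add, map_smul, apply_ite (contr q x L), map_zero]

theorem weightPow_contr {q : ℝ} (hq : 0 < q) (k : ℤ) {x L : ℕ} (f : Wave (L + 2)) :
    weightPow q k L (contr q x L f) = contr q x L (weightPow q k (L + 2) f) := by
  induction x generalizing L with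
  | zero =>
    have hq' : (q : ℂ) ≠ 0 := by exact_mod_cast hq.ne'
    simp only [contr_zero, slice_weightPow hq (L := L + 1), slice_weightPow hq, map_sub, map_smul]
    simp [smul_smul, -Complex.coe_smul, hq', zpow_ne_zero]
  | succ x ih =>
    cases L with
    | zero => simp only [contr_of_lt q (x := x + 1) (L := 0) (by omega), map_zero]
    | succ L =>
      refine wave_ext fun a => ?_
      rw [slice_weightPow hq, slice_contr_succ, slice_contr_succ, ih,
        slice_weightPow hq (L := L + 2), map_smul]

theorem lower_contr {q : ℝ} (hq : 0 < q) {x L : ℕ} (f : Wave (L + 2)) :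
    lower q L (contr q x L f) = contr q x L (lower q (L + 2) f) := by
  induction x generalizing L with
  | zero =>
    have hq' : (q : ℂ) ≠ 0 := by exact_mod_cast hq.ne'
    simp only [contr_zero, slice_lower (L := L + 1), slice_lower, map_sub, map_add, map_smul]
    simp [smul_smul, -Complex.coe_smul, hq', slice_weightPow hq]
  | succ x ih =>
    cases L with
    | zero => simp only [contr_of_lt q (x := x + 1) (L := 0) (by omega), map_zero]
    | succ L =>
      refine wave_ext fun a => ?_
      rw [slice_lower, slice_contr_succ, slice_contr_succ, slice_contr_succ, ih,
        slice_lower (L := L + 2), map_add, apply_ite (contr q x L), map_zero, weightPow_contr hq]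

theorem raise_ham {Δ : ℝ} (hΔ : 1 ≤ Δ) {L : ℕ} (f : Wave L) :
    raise (qParam Δ) L (ham Δ L f) = ham Δ L (raise (qParam Δ) L f) := by
  have hq := (qParam_spec hΔ).1
  match L, f with
  | 0, f => simp only [ham_zero, map_zero]
  | 1, f => simp only [ham_one, map_zero]
  | L + 2, f =>
    simp only [ham_eq_sum hΔ, map_sum, singletProj_apply, map_smul,
      raise_ins hq, raise_contr hq]

theorem lower_ham {Δ : ℝ} (hΔ : 1 ≤ Δ) {L : ℕ} (f : Wave L) :
    lower (qParam Δ) L (ham Δ L f) = ham Δ L (lower (qParam Δ) L f) := by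
  have hq := (qParam_spec hΔ).1
  match L, f with
  | 0, f => simp only [ham_zero, map_zero]
  | 1, f => simp only [ham_one, map_zero]
  | L + 2, f =>
    simp only [ham_eq_sum hΔ, map_sum, singletProj_apply, map_smul,
      lower_ins hq, lower_contr hq]

theorem spinZ_ham {Δ : ℝ} (hΔ : 1 ≤ Δ) {L : ℕ} (f : Wave L) :
    spinZ L (ham Δ L f) = ham Δ L (spinZ L f) := by
  match L, f with
  | 0, f => simp only [ham_zero, map_zero]
  | 1, f => simp only [ham_one, map_zero]
  | L + 2, f =>
    simp only [ham_eq_sum hΔ, map_sum, singletProj_apply, map_smul,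
      spinZ_ins, spinZ_contr]

/-! ### Adjoints -/

theorem inner_contr (q : ℝ) {x L : ℕ} (f : Wave (L + 2)) (g : Wave L) :
    star (contr q x L f) ⬝ᵥ g = star f ⬝ᵥ ins q x L g := by
  rw [star_dotProduct, ← inner_ins, ← star_dotProduct]

theorem inner_singletProj (q : ℝ) {x L : ℕ} (f g : Wave (L + 2)) :
    star f ⬝ᵥ singletProj q x L g =
      (1 + (q : ℂ) ^ 2)⁻¹ * (star (contr q x L f) ⬝ᵥ contr q x L g) := by
  rw [singletProj_apply, dotProduct_smul, inner_contr, smul_eq_mul]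

theorem singletProj_symm (q : ℝ) {x L : ℕ} (f g : Wave (L + 2)) :
    star (singletProj q x L f) ⬝ᵥ g = star f ⬝ᵥ singletProj q x L g := by
  rw [star_dotProduct, inner_singletProj, inner_singletProj, star_mul', ← star_dotProduct]
  simp

theorem ham_symm {Δ : ℝ} (hΔ : 1 ≤ Δ) {L : ℕ} (f g : Wave L) :
    star (ham Δ L f) ⬝ᵥ g = star f ⬝ᵥ ham Δ L g := by
  match L, f, g with
  | 0, f, g => simp only [ham_zero, star_zero, zero_dotProduct, dotProduct_zero]
  | 1, f, g => simp only [ham_one, star_zero, zero_dotProduct, dotProduct_zero]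
  | L + 2, f, g =>
    simp only [ham_eq_sum hΔ, star_sum, sum_dotProduct, dotProduct_sum,
      singletProj_symm]

theorem raise_zero (q : ℝ) (f : Wave 0) : raise q 0 f = 0 := by
  simp [raise_apply, genPlus]

theorem lower_zero (q : ℝ) (f : Wave 0) : lower q 0 f = 0 := by
  simp [lower_apply, genMinus]

theorem spinZ_zero (f : Wave 0) : spinZ 0 f = 0 := by
  simp [spinZ_apply, genS3]

theorem weightPow_neg_cancel {q : ℝ} (hq : 0 < q) (k : ℤ) {L : ℕ} (f : Wave L) :
    weightPow q k L (weightPow q (-k) L f) = f := by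
  have hq' : (q : ℂ) ≠ 0 := by exact_mod_cast hq.ne'
  funext σ
  simp only [weightPow_apply, qPow_mulVec, ← mul_assoc, ← Complex.ofReal_mul, ← zpow_add₀ hq.ne']
  simp

/-- Up to a power of `q ^ (2 S³)`, the lowering operator is the adjoint of the raising operator. -/
theorem inner_raise {q : ℝ} (hq : 0 < q) {L : ℕ} (f g : Wave L) :
    star (raise q L f) ⬝ᵥ g = (q : ℂ) * (star f ⬝ᵥ weightPow q 1 L (lower q L g)) := by
  have hq' : (q : ℂ) ≠ 0 := by exact_mod_cast hq.ne'
  induction L with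
  | zero => simp [raise_zero, lower_zero]
  | succ L ih =>
    rw [inner_succ, inner_succ]
    simp only [slice_raise hq, slice_weightPow hq, slice_lower, star_add, star_smul,
      add_dotProduct, smul_dotProduct, ih, map_add, apply_ite (weightPow q 1 L),
      weightPow_neg_cancel hq]
    simp
    field_simp
    ring

theorem inner_lower {q : ℝ} (hq : 0 < q) {L : ℕ} (f g : Wave L) :
    star (weightPow q 1 L f) ⬝ᵥ lower q L g = (q : ℂ)⁻¹ * (star (raise q L f) ⬝ᵥ g) := by
  have hq' : (q : ℂ) ≠ 0 := by exact_mod_cast hq.ne'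
  rw [inner_raise hq, inv_mul_cancel_left₀ hq']
  simp only [dotProduct, weightPow_apply, qPow_mulVec, Pi.star_apply]
  refine Finset.sum_congr rfl fun σ _ => ?_
  simp
  ring

/-! ### Weights -/

/-- The wave function `f` has `S³`-eigenvalue `d / 2`. -/
def IsWeight {L : ℕ} (d : ℤ) (f : Wave L) : Prop := spinZ L f = ((d : ℂ) / 2) • f

/-- The operator `S³` is diagonal in the Ising basis. -/
theorem spinZ_coord {L : ℕ} (f : Wave L) (σ : Fin L → Fin 2) :
    spinZ L f σ = ((∑ y, twoSz (σ y) : ℤ) : ℂ) / 2 * f σ := by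
  induction L with
  | zero => simp [spinZ_zero]
  | succ L ih =>
    have h := congrFun (slice_spinZ f (σ 0)) (vecTail σ)
    rw [slice_apply, Pi.add_apply, ih, Pi.smul_apply, slice_apply,
      show vecCons (σ 0) (vecTail σ) = σ from cons_head_tail σ] at h
    rw [h, Fin.sum_univ_succ]
    simp [vecTail]
    ring

theorem IsWeight.sum_eq {L : ℕ} {d : ℤ} {f : Wave L} (h : IsWeight d f) {σ : Fin L → Fin 2}
    (hσ : f σ ≠ 0) : ∑ y, twoSz (σ y) = d := by
  have h1 := congrFun h σ
  rw [spinZ_coord, Pi.smul_apply, smul_eq_mul] at h1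
  have h2 := mul_right_cancel₀ hσ h1
  field_simp at h2
  exact_mod_cast h2

theorem IsWeight.weightPow_eq {q : ℝ} {L : ℕ} {d : ℤ} {f : Wave L} (h : IsWeight d f) (k : ℤ) :
    weightPow q k L f = ((q ^ (k * d) : ℝ) : ℂ) • f := by
  funext σ
  rw [weightPow_apply, qPow_mulVec, Pi.smul_apply, smul_eq_mul]
  by_cases hσ : f σ = 0
  · simp [hσ]
  · rw [h.sum_eq hσ]

theorem IsWeight.le {L : ℕ} {d : ℤ} {f : Wave L} (h : IsWeight d f) (hf : f ≠ 0) : d ≤ L := by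
  obtain ⟨σ, hσ⟩ := Function.ne_iff.1 hf
  rw [← h.sum_eq hσ]
  calc ∑ y, twoSz (σ y) ≤ ∑ _ : Fin L, 1 := Finset.sum_le_sum fun y _ => by
        unfold twoSz; split_ifs <;> norm_num
    _ = L := by simp

theorem IsWeight.slice {L : ℕ} {d : ℤ} {f : Wave (L + 1)} (h : IsWeight d f) (a : Fin 2) :
    IsWeight (d - twoSz a) (slice a f) := by
  have h1 := slice_spinZ f a
  rw [h, map_smul] at h1
  rw [IsWeight, ← sub_eq_iff_eq_add'.2 h1]
  push_cast
  module

theorem spinZ_raise {q : ℝ} (hq : 0 < q) {L : ℕ} (f : Wave L) :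
    spinZ L (raise q L f) = raise q L (spinZ L f) + raise q L f := by
  induction L with
  | zero => simp [spinZ_zero, raise_zero]
  | succ L ih =>
    refine wave_ext fun a => ?_
    simp only [slice_spinZ, slice_raise hq, map_add, map_smul, ih]
    fin_cases a <;> simp <;> module

theorem spinZ_weightPow {q : ℝ} {k : ℤ} {L : ℕ} (f : Wave L) :
    spinZ L (weightPow q k L f) = weightPow q k L (spinZ L f) := by
  funext σ
  simp only [spinZ_coord, weightPow_apply, qPow_mulVec]
  ring

theorem spinZ_lower {q : ℝ} {L : ℕ} (f : Wave L) :
    spinZ L (lower q L f) = lower q L (spinZ L f) - lower q L f := by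
  induction L with
  | zero => simp [spinZ_zero, lower_zero]
  | succ L ih =>
    refine wave_ext fun a => ?_
    simp only [slice_spinZ, slice_lower, map_add, map_sub, map_smul, ih]
    fin_cases a <;> simp [spinZ_weightPow] <;> module

theorem IsWeight.raise {q : ℝ} (hq : 0 < q) {L : ℕ} {d : ℤ} {f : Wave L} (h : IsWeight d f) :
    IsWeight (d + 2) (raise q L f) := by
  rw [IsWeight, spinZ_raise hq, h, map_smul]
  push_cast
  module

theorem IsWeight.lower {q : ℝ} {L : ℕ} {d : ℤ} {f : Wave L} (h : IsWeight d f) :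
    IsWeight (d - 2) (lower q L f) := by
  rw [IsWeight, spinZ_lower, h, map_smul]
  push_cast
  module

/-- The `q`-integer `(q ^ d - q ^ (-d)) / (q - q⁻¹)`, with its limit `d` at `q = 1`. -/
def qInt (q : ℝ) (d : ℤ) : ℝ := if q = 1 then d else (q ^ d - q ^ (-d)) / (q - q⁻¹)

theorem sub_inv_ne_zero {q : ℝ} (hq : 0 < q) (h1 : q ≠ 1) : q - q⁻¹ ≠ 0 := by
  intro h
  field_simp at h
  apply h1
  nlinarith

theorem qInt_zero (q : ℝ) : qInt q 0 = 0 := by simp [qInt]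

theorem qInt_add_one {q : ℝ} (hq : 0 < q) (d : ℤ) :
    qInt q (d + 1) = q * qInt q d + q ^ (-d) := by
  unfold qInt
  split_ifs with h
  · subst h; simp
  · have := sub_inv_ne_zero hq h
    rw [div_eq_iff this, add_mul, mul_assoc, div_mul_cancel₀ _ this, zpow_add₀ hq.ne',
      _root_.zpow_neg, _root_.zpow_neg, zpow_add₀ hq.ne', zpow_one]
    field_simp
    ring

theorem qInt_sub_one {q : ℝ} (hq : 0 < q) (d : ℤ) :
    qInt q (d - 1) = q⁻¹ * qInt q d - q⁻¹ * q ^ (1 - d) := by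
  have h := qInt_add_one hq (d - 1)
  rw [sub_add_cancel, neg_sub] at h
  rw [h]
  field_simp
  ring

theorem qInt_pos {q : ℝ} (hq : 0 < q) (k : ℕ) : 0 < qInt q (k + 1) := by
  induction k with
  | zero =>
    rw [Nat.cast_zero, qInt_add_one hq, qInt_zero]
    simp
  | succ k ih =>
    rw [qInt_add_one hq]
    push_cast
    positivity

/-- The commutator of the raising and the lowering operator on a vector of given weight. -/
theorem raise_lower_sub {q : ℝ} (hq : 0 < q) {L : ℕ} {d : ℤ} {f : Wave L} (h : IsWeight d f) :
    raise q L (lower q L f) - lower q L (raise q L f) = (qInt q d : ℂ) • f := by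
  have hq' : (q : ℂ) ≠ 0 := by exact_mod_cast hq.ne'
  induction L generalizing d with
  | zero =>
    rw [raise_zero, raise_zero, map_zero, sub_zero]
    by_cases hf : f = 0
    · rw [hf, smul_zero]
    · obtain ⟨σ, hσ⟩ := Function.ne_iff.1 hf
      have := h.sum_eq hσ
      rw [← this]
      simp [qInt_zero]
  | succ L ih =>
    have h0 : IsWeight (d - 1) (slice 0 f) := h.slice 0
    have h1 : IsWeight (d + 1) (slice 1 f) := by simpa using h.slice 1
    have e0 := ih h0
    have e1 := ih h1
    rw [sub_eq_iff_eq_add] at e0 e1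
    refine wave_ext fun a => ?_
    simp only [map_sub, map_smul, slice_raise hq, slice_lower]
    fin_cases a
    · simp only [Fin.zero_eta, if_true, e0, h0.weightPow_eq, map_add, map_smul, twoSz_zero,
        if_neg (show (0 : Fin 2) ≠ 1 by decide), zero_add, zpow_one]
      have := qInt_add_one hq (d - 1)
      rw [sub_add_cancel, neg_sub] at this
      rw [this, show -1 * (d - 1) = 1 - d by ring]
      push_cast
      module
    · simp only [Fin.mk_one, if_true, e1, h0.weightPow_eq, h1.weightPow_eq,
        (h0.raise hq).weightPow_eq, map_add, map_smul, twoSz_zero, twoSz_one,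
        if_neg (show (1 : Fin 2) ≠ 0 by decide), zero_add]
      have := qInt_sub_one hq (d + 1)
      rw [add_sub_cancel_right] at this
      rw [this, show -1 * (d - 1) = -d + 1 by ring, show -1 * (d - 1 + 2) = -d - 1 by ring,
        show -1 * (d + 1) = -d - 1 by ring, show 1 - (d + 1) = -d by ring,
        zpow_add₀ hq.ne', zpow_sub₀ hq.ne']
      push_cast
      simp only [_root_.zpow_neg_one, _root_.zpow_one]
      match_scalars <;> field_simp <;> ring

/-! ### Highest weight vectors and singlet patterns -/

/-- The highest weight vectors of weight `d / 2`: those of `S³`-eigenvalue `d / 2` that are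
annihilated by the raising operator. -/
def highest (q : ℝ) (L : ℕ) (d : ℤ) : Submodule ℂ (Wave L) where
  carrier := {f | raise q L f = 0 ∧ IsWeight d f}
  add_mem' := by
    rintro f g ⟨hf, hf'⟩ ⟨hg, hg'⟩
    refine ⟨by rw [map_add, hf, hg, add_zero], ?_⟩
    rw [IsWeight, map_add, hf', hg', smul_add]
  zero_mem' := ⟨map_zero _, by rw [IsWeight, map_zero, smul_zero]⟩
  smul_mem' := by
    rintro c f ⟨hf, hf'⟩
    refine ⟨by rw [map_smul, hf, smul_zero], ?_⟩
    rw [IsWeight, map_smul, hf', smul_comm]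

theorem mem_highest {q : ℝ} {L : ℕ} {d : ℤ} {f : Wave L} :
    f ∈ highest q L d ↔ raise q L f = 0 ∧ IsWeight d f := Iff.rfl

/-- The state `↑ ⊗ f`. -/
def prependUp {L : ℕ} : Wave L →ₗ[ℂ] Wave (L + 1) := glue fun a => if a = 0 then LinearMap.id else 0

@[simp] theorem slice_zero_prependUp {L : ℕ} (f : Wave L) : slice 0 (prependUp f) = f := by
  simp [prependUp]

@[simp] theorem slice_one_prependUp {L : ℕ} (f : Wave L) : slice 1 (prependUp f) = 0 := by
  simp [prependUp]

theorem prependUp_ins (q : ℝ) {x L : ℕ} (f : Wave L) :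
    prependUp (ins q x L f) = ins q (x + 1) (L + 1) (prependUp f) := by
  refine wave_ext (L := L + 2) fun a => ?_
  rw [slice_ins_succ]
  fin_cases a <;> simp

theorem eq_prependUp {L : ℕ} {f : Wave (L + 1)} (h : slice 1 f = 0) :
    f = prependUp (slice 0 f) := by
  refine wave_ext fun a => ?_
  fin_cases a <;> simp [h]

/-- The state with all spins up. -/
def allUp : (L : ℕ) → Wave L
  | 0 => 1
  | L + 1 => prependUp (allUp L)

/-- The states obtained from the state of `d` up spins by inserting neighbouring singlets one after
the other: the product states of singlets along the arcs of a noncrossing pairing, and up spins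
at the `d` unpaired sites, none of which lies below an arc. -/
inductive Pattern (q : ℝ) (d : ℕ) : (L : ℕ) → Wave L → Prop
  | up : Pattern q d d (allUp d)
  | ins {L x : ℕ} {f : Wave L} : x ≤ L → Pattern q d L f → Pattern q d (L + 2) (ins q x L f)

theorem allUp_mem_highest {q : ℝ} (hq : 0 < q) (L : ℕ) : allUp L ∈ highest q L L := by
  induction L with
  | zero =>
    refine ⟨raise_zero q _, ?_⟩
    rw [IsWeight, spinZ_zero]
    simp
  | succ L ih =>
    refine ⟨wave_ext fun a => ?_, wave_ext fun a => ?_⟩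
    · rw [slice_raise hq]
      fin_cases a <;> simp [allUp, ih.1]
    · rw [slice_spinZ, map_smul]
      fin_cases a
      · simp [allUp, show spinZ L (allUp L) = _ from ih.2]
        module
      · simp [allUp]

theorem Pattern.mem_highest {q : ℝ} (hq : 0 < q) {d L : ℕ} {f : Wave L} (h : Pattern q d L f) :
    f ∈ highest q L d := by
  induction h with
  | up => exact allUp_mem_highest hq d
  | ins _ _ ih =>
    refine ⟨by rw [raise_ins hq, ih.1, map_zero], ?_⟩
    rw [IsWeight, spinZ_ins, ih.2, map_smul]

theorem Pattern.prependUp {q : ℝ} {d L : ℕ} {f : Wave L} (h : Pattern q d L f) :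
    Pattern q (d + 1) (L + 1) (prependUp f) := by
  induction h with
  | up => exact Pattern.up
  | ins hx _ ih =>
    rw [prependUp_ins]
    exact ih.ins (by omega)

/-- Pairing a new first site with the first unpaired site of a pattern. -/
theorem Pattern.exists_slice_one {q : ℝ} {d L : ℕ} {f : Wave L} (h : Pattern q (d + 1) L f) :
    ∃ g, Pattern q d (L + 1) g ∧ slice 1 g = -(q : ℂ) • f := by
  generalize he : d + 1 = e at h
  induction h with
  | up =>
    subst he
    refine ⟨XXZ.ins q 0 d (allUp d), (Pattern.up).ins (Nat.zero_le _), wave_ext fun a => ?_⟩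
    rw [slice_ins_zero]
    fin_cases a <;> simp [allUp, singlet_self]
  | @ins L x f hx _ ih =>
    obtain ⟨g, hg, hg'⟩ := ih
    refine ⟨XXZ.ins q (x + 1) (L + 1) g, hg.ins (by omega), ?_⟩
    rw [slice_ins_succ, hg', map_smul]

theorem contr_allUp (q : ℝ) (x L : ℕ) : contr q x L (allUp (L + 2)) = 0 := by
  induction x generalizing L with
  | zero => simp [contr_zero, allUp]
  | succ x ih =>
    cases L with
    | zero => exact contr_of_lt q (by omega) _
    | succ L =>
      refine wave_ext fun a => ?_
      rw [slice_contr_succ, allUp]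
      fin_cases a <;> simp [ih]

/-- The Temperley–Lieb action on patterns: the contraction of two neighbouring sites of a pattern
in which they are not paired with each other is zero or, up to the negative factor `-q`, again a
pattern. -/
theorem Pattern.contr_cases {q : ℝ} {d L : ℕ} {f : Wave (L + 2)} (h : Pattern q d (L + 2) f)
    {x : ℕ} (hx : x ≤ L) :
    (∃ g, Pattern q d L g ∧ f = XXZ.ins q x L g) ∨ contr q x L f = 0 ∨
      ∃ g, Pattern q d L g ∧ contr q x L f = -(q : ℂ) • g := by
  induction L using Nat.strong_induction_on generalizing d x with
  | _ L ih =>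
    cases h with
    | up => exact Or.inr (Or.inl (contr_allUp q x L))
    | @ins _ y g hy hg =>
      rcases lt_trichotomy x y with hxy | rfl | hxy
      · by_cases hxy' : y = x + 1
        · subst hxy'
          exact Or.inr (Or.inr ⟨g, hg, contr_ins_succ q hy g⟩)
        obtain ⟨y, rfl⟩ : ∃ z, y = z + 2 := ⟨y - 2, by omega⟩
        obtain ⟨L, rfl⟩ : ∃ K, L = K + 2 := ⟨L - 2, by omega⟩
        rw [contr_ins_add_two q (by omega)]
        rcases ih L (by omega) hg (x := x) (by omega) with ⟨g', hg', rfl⟩ | h0 | ⟨g', hg', h0⟩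
        · refine Or.inl ⟨XXZ.ins q y L g', hg'.ins (by omega), (ins_ins q (by omega) g').symm⟩
        · exact Or.inr (Or.inl (by rw [h0, map_zero]))
        · exact Or.inr (Or.inr ⟨XXZ.ins q y L g', hg'.ins (by omega), by rw [h0, map_smul]⟩)
      · exact Or.inl ⟨g, hg, rfl⟩
      · by_cases hxy' : x = y + 1
        · subst hxy'
          exact Or.inr (Or.inr ⟨g, hg, contr_succ_ins q hx g⟩)
        obtain ⟨x, rfl⟩ : ∃ z, x = z + 2 := ⟨x - 2, by omega⟩
        obtain ⟨L, rfl⟩ : ∃ K, L = K + 2 := ⟨L - 2, by omega⟩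
        rw [contr_add_two_ins q (by omega)]
        rcases ih L (by omega) hg (x := x) (by omega) with ⟨g', hg', rfl⟩ | h0 | ⟨g', hg', h0⟩
        · refine Or.inl ⟨XXZ.ins q y L g', hg'.ins (by omega), ins_ins q (by omega) g'⟩
        · exact Or.inr (Or.inl (by rw [h0, map_zero]))
        · exact Or.inr (Or.inr ⟨XXZ.ins q y L g', hg'.ins (by omega), by rw [h0, map_smul]⟩)

theorem setOf_pattern_finite (q : ℝ) (d L : ℕ) : {f | Pattern q d L f}.Finite := by
  induction L using Nat.strong_induction_on with
  | _ L ih =>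
    rcases lt_or_ge L 2 with hL | hL
    · refine (Set.finite_singleton (allUp L)).subset ?_
      intro f hf
      cases hf with
      | up => rfl
      | ins => omega
    · obtain ⟨L, rfl⟩ : ∃ K, L = K + 2 := ⟨L - 2, by omega⟩
      refine ((Set.finite_singleton (allUp (L + 2))).union
        ((Set.finite_Iic L).biUnion fun x _ => (ih L (by omega)).image (XXZ.ins q x L))).subset ?_
      intro f hf
      cases hf with
      | up => exact Or.inl rfl
      | ins hx hg => exact Or.inr (Set.mem_biUnion (Set.mem_Iic.2 hx) ⟨_, hg, rfl⟩)

/-! ### A functional that is positive on patterns -/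

/-- The pairing with the product of the states `↑ + b x ↓` of the sites `x`. -/
def pairing : (L : ℕ) → (ℕ → ℝ) → Wave L →ₗ[ℂ] ℂ
  | 0, _ => LinearMap.proj ![]
  | L + 1, b => pairing L (fun i => b (i + 1)) ∘ₗ slice 0 +
      (b 0 : ℂ) • pairing L (fun i => b (i + 1)) ∘ₗ slice 1

theorem pairing_succ {L : ℕ} (b : ℕ → ℝ) (f : Wave (L + 1)) :
    pairing (L + 1) b f = pairing L (fun i => b (i + 1)) (slice 0 f) +
      (b 0 : ℂ) * pairing L (fun i => b (i + 1)) (slice 1 f) := rfl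

/-- The sequence `b` without its entries `x` and `x + 1`. -/
def dropTwo (x : ℕ) (b : ℕ → ℝ) (i : ℕ) : ℝ := if i < x then b i else b (i + 2)

theorem pairing_ins (q : ℝ) {x L : ℕ} (hx : x ≤ L) (b : ℕ → ℝ) (f : Wave L) :
    pairing (L + 2) b (ins q x L f) =
      ((b (x + 1) - q * b x : ℝ) : ℂ) * pairing L (dropTwo x b) f := by
  induction x generalizing L b with
  | zero =>
    have h : dropTwo 0 b = fun i => b (i + 1 + 1) := by
      funext i
      simp [dropTwo]
    rw [pairing_succ (L := L + 1), pairing_succ, pairing_succ]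
    simp only [slice_ins_zero, h, singlet_self, singlet_zero_one, singlet_one_zero]
    simp
    ring
  | succ x ih =>
    obtain ⟨L, rfl⟩ : ∃ K, L = K + 1 := ⟨L - 1, by omega⟩
    have h : dropTwo x (fun i => b (i + 1)) = fun i => dropTwo (x + 1) b (i + 1) := by
      funext i
      simp only [dropTwo, add_lt_add_iff_right]
    have h0 : dropTwo (x + 1) b 0 = b 0 := by simp [dropTwo]
    rw [pairing_succ (L := L + 2), slice_ins_succ, slice_ins_succ, ih (by omega),
      ih (by omega), h, pairing_succ, h0]
    ring

theorem dropTwo_strictMono {b : ℕ → ℝ} (hb : StrictMono b) (x : ℕ) : StrictMono (dropTwo x b) := by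
  intro i j hij
  unfold dropTwo
  split_ifs <;> exact hb (by omega)

theorem pairing_allUp (L : ℕ) (b : ℕ → ℝ) : pairing L b (allUp L) = 1 := by
  induction L generalizing b with
  | zero => rfl
  | succ L ih => simp [pairing_succ, allUp, ih]

theorem Pattern.pairing_pos {q : ℝ} (hq1 : q ≤ 1) {d L : ℕ} {f : Wave L} (h : Pattern q d L f)
    {b : ℕ → ℝ} (hb : StrictMono b) (hb0 : ∀ i, 0 ≤ b i) :
    ∃ r : ℝ, 0 < r ∧ pairing L b f = r := by
  induction h generalizing b with
  | up => exact ⟨1, one_pos, by rw [pairing_allUp, Complex.ofReal_one]⟩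
  | @ins L x f hx _ ih =>
    obtain ⟨r, hr, hr'⟩ := ih (dropTwo_strictMono hb x) fun i => by
      unfold dropTwo
      split_ifs <;> exact hb0 _
    refine ⟨(b (x + 1) - q * b x) * r, mul_pos ?_ hr, ?_⟩
    · have := hb (Nat.lt_succ_self x)
      nlinarith [hb0 x]
    · rw [pairing_ins q hx, hr', Complex.ofReal_mul]

theorem Pattern.ne_zero {q : ℝ} (hq1 : q ≤ 1) {d L : ℕ} {f : Wave L} (h : Pattern q d L f) :
    f ≠ 0 := by
  rintro rfl
  obtain ⟨r, hr, hr'⟩ := h.pairing_pos hq1 (b := fun i => (i : ℝ)) Nat.strictMono_cast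
    fun i => Nat.cast_nonneg i
  rw [map_zero, eq_comm, Complex.ofReal_eq_zero] at hr'
  exact hr.ne' hr'

/-! ### Patterns span the highest weight vectors -/

/-- The span of the patterns with `d` unpaired sites; it is zero for `d < 0`. -/
def patternSpan (q : ℝ) (L : ℕ) (d : ℤ) : Submodule ℂ (Wave L) :=
  Submodule.span ℂ {f | ∃ k : ℕ, (k : ℤ) = d ∧ Pattern q k L f}

theorem patternSpan_le {q : ℝ} (hq : 0 < q) {L : ℕ} {d : ℤ} :
    patternSpan q L d ≤ highest q L d := by
  refine Submodule.span_le.2 ?_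
  rintro f ⟨k, rfl, hf⟩
  exact hf.mem_highest hq

theorem patternSpan_of_neg {q : ℝ} {L : ℕ} {d : ℤ} (hd : d < 0) : patternSpan q L d = ⊥ := by
  rw [patternSpan, Submodule.span_eq_bot]
  rintro f ⟨k, hk, -⟩
  omega

/-- A pattern without unpaired sites is a singlet of the quantum group, so it is orthogonal to the
range of the raising operator. -/
theorem Pattern.inner_raise_eq_zero {q : ℝ} (hq : 0 < q) {L : ℕ} {f : Wave L}
    (h : Pattern q 0 L f) (g : Wave L) : star f ⬝ᵥ raise q L g = 0 := by
  generalize he : 0 = e at h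
  induction h with
  | up =>
    subst he
    rw [raise_zero, dotProduct_zero]
  | ins _ _ ih => rw [inner_ins, ← raise_contr hq, ih]

theorem slice_one_mem {q : ℝ} (hq : 0 < q) {L : ℕ} {d : ℤ} {f : Wave (L + 1)}
    (hf : f ∈ highest q (L + 1) d) : slice 1 f ∈ highest q L (d + 1) := by
  refine ⟨?_, by simpa using hf.2.slice 1⟩
  have h := slice_raise hq f 1
  rw [hf.1, map_zero, if_neg (by decide), zero_add] at h
  refine (smul_eq_zero.1 h.symm).resolve_left ?_
  exact_mod_cast (zpow_pos hq _).ne'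

theorem slice_one_eq {q : ℝ} (hq : 0 < q) {L : ℕ} {d : ℤ} {f : Wave (L + 1)}
    (hf : f ∈ highest q (L + 1) d) : slice 1 f = -(q : ℂ) • raise q L (slice 0 f) := by
  have h := slice_raise hq f 0
  rw [hf.1, map_zero, if_pos rfl, twoSz_zero, zpow_one] at h
  rw [neg_smul]
  exact eq_neg_of_add_eq_zero_left h.symm

theorem slice_zero_mem {q : ℝ} (hq : 0 < q) {L : ℕ} {d : ℤ} {f : Wave (L + 1)}
    (hf : f ∈ highest q (L + 1) d) (h : slice 1 f = 0) : slice 0 f ∈ highest q L (d - 1) := by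
  refine ⟨?_, hf.2.slice 0⟩
  have hq' : -(q : ℂ) ≠ 0 := by exact_mod_cast neg_ne_zero.2 hq.ne'
  rw [slice_one_eq hq hf] at h
  exact (smul_eq_zero.1 h).resolve_left hq'

theorem exists_slice_one_of_mem {q : ℝ} (hq : 0 < q) {L : ℕ} {d : ℤ} (hd : d + 1 ≠ 0) {f : Wave L}
    (hf : f ∈ patternSpan q L (d + 1)) : ∃ g ∈ patternSpan q (L + 1) d, slice 1 g = f := by
  have hq' : -(q : ℂ) ≠ 0 := by exact_mod_cast neg_ne_zero.2 hq.ne'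
  suffices patternSpan q L (d + 1) ≤ (patternSpan q (L + 1) d).map (slice 1) from
    Submodule.mem_map.1 (this hf)
  refine Submodule.span_le.2 ?_
  rintro f ⟨k, hk, hf⟩
  obtain ⟨k, rfl⟩ : ∃ j, k = j + 1 := ⟨k - 1, by omega⟩
  obtain ⟨g, hg, hg'⟩ := hf.exists_slice_one
  refine ⟨(-(q : ℂ))⁻¹ • g, Submodule.smul_mem _ _ (Submodule.subset_span ⟨k, by omega, hg⟩), ?_⟩
  rw [map_smul, hg', smul_smul, inv_mul_cancel₀ hq', one_smul]

theorem prependUp_mem {q : ℝ} {L : ℕ} {d : ℤ} {f : Wave L} (hf : f ∈ patternSpan q L (d - 1)) :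
    prependUp f ∈ patternSpan q (L + 1) d := by
  suffices patternSpan q L (d - 1) ≤ (patternSpan q (L + 1) d).comap prependUp from this hf
  refine Submodule.span_le.2 ?_
  rintro f ⟨k, hk, hf⟩
  exact Submodule.subset_span ⟨k + 1, by push_cast; omega, hf.prependUp⟩

/-- Every highest weight vector is a combination of patterns. The component of the vector with first
spin down is a highest weight vector of one site less; unless all of its sites are paired, its
patterns are completed to patterns by pairing the first site, and what remains has first spin
up. -/
theorem highest_le {q : ℝ} (hq : 0 < q) (L : ℕ) (d : ℤ) :
    highest q L d ≤ patternSpan q L d := by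
  induction L generalizing d with
  | zero =>
    intro f hf
    by_cases h : f = 0
    · rw [h]
      exact zero_mem _
    · obtain ⟨σ, hσ⟩ := Function.ne_iff.1 h
      have hd := hf.2.sum_eq hσ
      have : f = f ![] • allUp 0 := by
        funext τ
        rw [Subsingleton.elim τ ![]]
        simp [allUp]
      rw [this]
      exact Submodule.smul_mem _ _ (Submodule.subset_span ⟨0, by simpa using hd, Pattern.up⟩)
  | succ L ih =>
    intro f hf
    have h1 := ih _ (slice_one_mem hq hf)
    obtain ⟨g, hg, hg'⟩ : ∃ g ∈ patternSpan q (L + 1) d, slice 1 g = slice 1 f := by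
      by_cases hd : d + 1 = 0
      -- Here `slice 1 f` is a combination of singlets, but lies in the range of `raise`.
      · refine ⟨0, zero_mem _, ?_⟩
        rw [map_zero, eq_comm, ← inner_self_eq_zero_iff]
        nth_rewrite 2 [slice_one_eq hq hf]
        rw [dotProduct_smul]
        rw [hd] at h1
        refine smul_eq_zero_of_right _ ?_
        refine Submodule.span_induction (p := fun f _ => star f ⬝ᵥ raise q L _ = 0) ?_ ?_ ?_ ?_ h1
        · rintro p ⟨k, hk, hp⟩
          obtain rfl : k = 0 := by omega
          exact hp.inner_raise_eq_zero hq _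
        · rw [star_zero, zero_dotProduct]
        · intro x y _ _ hx hy
          rw [star_add, add_dotProduct, hx, hy, add_zero]
        · intro c x _ hx
          rw [star_smul, smul_dotProduct, hx, smul_zero]
      · exact exists_slice_one_of_mem hq hd h1
    have h0 : slice 1 (f - g) = 0 := by rw [map_sub, hg', sub_self]
    have hfg := Submodule.sub_mem _ hf (patternSpan_le hq hg)
    have := prependUp_mem (ih _ (slice_zero_mem hq hfg h0))
    rw [← eq_prependUp h0] at this
    simpa using Submodule.add_mem _ this hg

theorem highest_of_neg {q : ℝ} (hq : 0 < q) {L : ℕ} {d : ℤ} (hd : d < 0) :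
    highest q L d = ⊥ :=
  le_bot_iff.1 ((highest_le hq L d).trans (patternSpan_of_neg hd).le)

/-! ### The cone of patterns -/

/-- The cone generated by the patterns. -/
def cone (q : ℝ) (d L : ℕ) : Submodule ℝ≥0 (Wave L) := Submodule.span ℝ≥0 {f | Pattern q d L f}

theorem Pattern.mem_cone {q : ℝ} {d L : ℕ} {f : Wave L} (h : Pattern q d L f) : f ∈ cone q d L :=
  Submodule.subset_span h

theorem smul_mem_cone {q : ℝ} {d L : ℕ} {f : Wave L} (h : f ∈ cone q d L) {r : ℝ} (hr : 0 ≤ r) :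
    (r : ℂ) • f ∈ cone q d L :=
  Submodule.smul_mem (cone q d L) (⟨r, hr⟩ : ℝ≥0) h

theorem map_mem_cone {q : ℝ} {d e L K : ℕ} (T : Wave L →ₗ[ℂ] Wave K)
    (hT : ∀ f, Pattern q d L f → T f ∈ cone q e K) {f : Wave L} (hf : f ∈ cone q d L) :
    T f ∈ cone q e K := by
  suffices cone q d L ≤ (cone q e K).comap (T.restrictScalars ℝ≥0) from this hf
  exact Submodule.span_le.2 hT

theorem singletProj_ins {q : ℝ} {x L : ℕ} (hx : x ≤ L) (f : Wave L) :
    singletProj q x L (ins q x L f) = ins q x L f := by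
  have hne : (1 + (q : ℂ) ^ 2) ≠ 0 := by
    have : (0 : ℝ) < 1 + q ^ 2 := by positivity
    exact_mod_cast this.ne'
  rw [singletProj_apply, contr_ins_self q hx, map_smul, smul_smul, inv_mul_cancel₀ hne, one_smul]

theorem neg_singletProj_mem {q : ℝ} (hq : 0 < q) {x d L : ℕ} {f : Wave (L + 2)} {g : Wave L}
    (hx : x ≤ L) (hg : Pattern q d L g) (h : contr q x L f = -(q : ℂ) • g) :
    -singletProj q x L f ∈ cone q d (L + 2) := by
  have := smul_mem_cone (hg.ins hx).mem_cone (r := (1 + q ^ 2)⁻¹ * q) (by positivity)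
  rw [singletProj_apply, h, map_smul, smul_smul, ← neg_smul]
  convert this using 2
  push_cast
  ring

theorem sub_singletProj_mem {q : ℝ} (hq : 0 < q) {x d L : ℕ} (hx : x ≤ L) {f : Wave (L + 2)}
    (hf : f ∈ cone q d (L + 2)) : f - singletProj q x L f ∈ cone q d (L + 2) := by
  refine map_mem_cone (LinearMap.id - singletProj q x L) (fun p hp => ?_) hf
  rw [LinearMap.sub_apply, LinearMap.id_apply]
  rcases hp.contr_cases hx with ⟨g, hg, rfl⟩ | h0 | ⟨g, hg, h⟩
  · rw [singletProj_ins hx, sub_self]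
    exact zero_mem _
  · rw [singletProj_apply, h0, map_zero, smul_zero, sub_zero]
    exact hp.mem_cone
  · rw [sub_eq_add_neg]
    exact add_mem hp.mem_cone (neg_singletProj_mem hq hx hg h)

/-- The interaction of a new up spin with a combination of patterns has only nonpositive
coefficients: the new site is unpaired, so the interaction does not fix any of the patterns. -/
theorem neg_singletProj_prependUp_mem {q : ℝ} (hq : 0 < q) {d L : ℕ} {f : Wave (L + 1)}
    (hf : f ∈ cone q d (L + 1)) :
    -singletProj q 0 L (prependUp f) ∈ cone q (d + 1) (L + 2) := by
  refine map_mem_cone (-(singletProj q 0 L ∘ₗ prependUp)) (fun p hp => ?_) hf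
  rw [LinearMap.neg_apply, LinearMap.comp_apply]
  rcases hp.prependUp.contr_cases (L := L) (Nat.zero_le _) with ⟨g, hg, h⟩ | h0 | ⟨g, hg, h⟩
  · have hs := slice_one_prependUp p
    have hq' : -(q : ℂ) ≠ 0 := by exact_mod_cast neg_ne_zero.2 hq.ne'
    -- The insertion has a component with first spin down unless the state `g` is zero.
    rw [h] at hs
    have hs' := slice_ins_zero q g 1 0
    rw [hs, map_zero, singlet_one_zero, eq_comm] at hs'
    rw [h, (smul_eq_zero.1 hs').resolve_left hq']
    simp
  · rw [singletProj_apply, h0, map_zero, smul_zero, neg_zero]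
    exact zero_mem _
  · exact neg_singletProj_mem hq (Nat.zero_le _) hg h

/-- For `c ≥ L` the operator `c - H` preserves the cone of patterns. -/
theorem sub_ham_mem {Δ : ℝ} (hΔ : 1 ≤ Δ) {d L : ℕ} {c : ℝ} (hc : L ≤ c) {f : Wave L}
    (hf : f ∈ cone (qParam Δ) d L) : (c : ℂ) • f - ham Δ L f ∈ cone (qParam Δ) d L := by
  have hc0 : 0 ≤ c := (Nat.cast_nonneg L).trans hc
  match L, f, hf with
  | 0, f, hf =>
    rw [ham_zero, sub_zero]
    exact smul_mem_cone hf hc0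
  | 1, f, hf =>
    rw [ham_one, sub_zero]
    exact smul_mem_cone hf hc0
  | L + 2, f, hf =>
    have h1 : (0 : ℝ) ≤ c - (L + 1) := by
      push_cast at hc
      linarith
    have h : (c : ℂ) • f - ham Δ (L + 2) f = ((c - (L + 1) : ℝ) : ℂ) • f +
        ∑ x ∈ Finset.range (L + 1), (f - singletProj (qParam Δ) x L f) := by
      rw [ham_eq_sum hΔ, Finset.sum_sub_distrib, Finset.sum_const, Finset.card_range,
        ← Nat.cast_smul_eq_nsmul ℂ]
      push_cast
      module
    rw [h]
    refine add_mem (smul_mem_cone hf h1) (sum_mem fun x hx => ?_)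
    exact sub_singletProj_mem (qParam_spec hΔ).1 (Nat.lt_succ_iff.1 (Finset.mem_range.1 hx)) hf

theorem pairing_nonneg {q : ℝ} (hq1 : q ≤ 1) {d L : ℕ} {f : Wave L} (hf : f ∈ cone q d L)
    {b : ℕ → ℝ} (hb : StrictMono b) (hb0 : ∀ i, 0 ≤ b i) :
    ∃ r : ℝ, 0 ≤ r ∧ pairing L b f = r := by
  refine Submodule.span_induction (p := fun f _ => ∃ r : ℝ, 0 ≤ r ∧ pairing L b f = r)
    ?_ ?_ ?_ ?_ hf
  · intro p hp
    obtain ⟨r, hr, h⟩ := hp.pairing_pos hq1 hb hb0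
    exact ⟨r, hr.le, h⟩
  · exact ⟨0, le_rfl, by simp⟩
  · rintro x y _ _ ⟨r, hr, h⟩ ⟨s, hs, h'⟩
    exact ⟨r + s, add_nonneg hr hs, by rw [map_add, h, h', Complex.ofReal_add]⟩
  · rintro c x _ ⟨r, hr, h⟩
    refine ⟨c * r, mul_nonneg c.2 hr, ?_⟩
    rw [show c • x = (c : ℂ) • x from rfl, map_smul, h]
    simp

/-- On the cone of patterns the norm is controlled by the pairing. -/
theorem exists_norm_le_pairing {q : ℝ} (hq1 : q ≤ 1) (d L : ℕ) {b : ℕ → ℝ} (hb : StrictMono b)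
    (hb0 : ∀ i, 0 ≤ b i) : ∃ C : ℝ, ∀ f ∈ cone q d L, ‖f‖ ≤ C * (pairing L b f).re := by
  obtain ⟨C, hC⟩ := ((setOf_pattern_finite q d L).image
    fun f => ‖f‖ / (pairing L b f).re).bddAbove
  refine ⟨C, fun f hf => ?_⟩
  refine Submodule.span_induction (p := fun f _ => ‖f‖ ≤ C * (pairing L b f).re) ?_ ?_ ?_ ?_ hf
  · intro p hp
    obtain ⟨r, hr, h⟩ := hp.pairing_pos hq1 hb hb0
    have := hC ⟨p, hp, rfl⟩
    simp only [h, Complex.ofReal_re] at this ⊢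
    exact (div_le_iff₀ hr).1 this
  · simp
  · intro x y _ _ hx hy
    rw [map_add, Complex.add_re, mul_add]
    exact (norm_add_le x y).trans (add_le_add hx hy)
  · intro c x _ hx
    rw [show c • x = (c : ℂ) • x from rfl, map_smul, norm_smul, smul_eq_mul]
    have hc : (0 : ℝ) ≤ c := c.2
    have : ‖(c : ℂ)‖ = c := by simp
    rw [this]
    have h2 : ((c : ℂ) * pairing L b x).re = c * (pairing L b x).re := by simp
    rw [h2]
    nlinarith

/-! ### Lowest eigenvalues on invariant subspaces -/

/-- The number `t` is the lowest eigenvalue of `T` on the subspace `V`. -/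
def IsGround {L : ℕ} (T : Wave L →ₗ[ℂ] Wave L) (V : Submodule ℂ (Wave L)) (t : ℝ) : Prop :=
  (∃ f ∈ V, f ≠ 0 ∧ T f = (t : ℂ) • f) ∧
    ∀ f ∈ V, t * (star f ⬝ᵥ f).re ≤ (star f ⬝ᵥ T f).re

theorem inner_self_im {L : ℕ} (f : Wave L) : (star f ⬝ᵥ f).im = 0 := by
  have h := congrArg Complex.im (star_dotProduct f f)
  rw [Complex.star_def, Complex.conj_im] at h
  linarith

theorem inner_self_nonneg {L : ℕ} (f : Wave L) : 0 ≤ (star f ⬝ᵥ f).re := by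
  rw [dotProduct, Complex.re_sum]
  refine Finset.sum_nonneg fun σ _ => ?_
  rw [Pi.star_apply, Complex.star_def, ← Complex.normSq_eq_conj_mul_self, Complex.ofReal_re]
  exact Complex.normSq_nonneg _

theorem inner_self_pos {L : ℕ} {f : Wave L} (hf : f ≠ 0) : 0 < (star f ⬝ᵥ f).re := by
  refine (inner_self_nonneg f).lt_of_ne' fun h => hf (inner_self_eq_zero_iff.1 ?_)
  exact Complex.ext h (inner_self_im f)

theorem IsGround.le {L : ℕ} {T : Wave L →ₗ[ℂ] Wave L} {V : Submodule ℂ (Wave L)} {t s : ℝ}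
    (h : IsGround T V t) {f : Wave L} (hf : f ∈ V) (hf0 : f ≠ 0) (hs : T f = (s : ℂ) • f) :
    t ≤ s := by
  have h1 := h.2 f hf
  rw [hs, dotProduct_smul, smul_eq_mul, Complex.re_ofReal_mul] at h1
  exact le_of_mul_le_mul_right h1 (inner_self_pos hf0)

/-- The spectral theorem for the restriction of a self-adjoint operator to an invariant subspace. -/
theorem exists_eigenbasis {L : ℕ} {T : Wave L →ₗ[ℂ] Wave L}
    (hT : ∀ f g, star (T f) ⬝ᵥ g = star f ⬝ᵥ T g) {V : Submodule ℂ (Wave L)}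
    (hV : ∀ f ∈ V, T f ∈ V) :
    ∃ (n : ℕ) (v : Fin n → Wave L) (μ : Fin n → ℝ), (∀ i, v i ∈ V) ∧
      (∀ i j, star (v i) ⬝ᵥ v j = if i = j then 1 else 0) ∧
      (∀ i, T (v i) = (μ i : ℂ) • v i) ∧ V ≤ Submodule.span ℂ (Set.range v) := by
  let e : EuclideanSpace ℂ (Fin L → Fin 2) ≃ₗ[ℂ] Wave L := WithLp.linearEquiv 2 ℂ _
  let S : EuclideanSpace ℂ (Fin L → Fin 2) →ₗ[ℂ] EuclideanSpace ℂ (Fin L → Fin 2) :=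
    e.symm.toLinearMap ∘ₗ T ∘ₗ e.toLinearMap
  have hin (x y : EuclideanSpace ℂ (Fin L → Fin 2)) : inner ℂ x y = star (e x) ⬝ᵥ e y := by
    rw [EuclideanSpace.inner_eq_star_dotProduct, dotProduct_comm]
    rfl
  have hS : S.IsSymmetric := by
    intro x y
    rw [hin, hin]
    exact hT (e x) (e y)
  let U : Submodule ℂ (EuclideanSpace ℂ (Fin L → Fin 2)) := V.comap e.toLinearMap
  have hU : ∀ x ∈ U, S x ∈ U := fun x hx => hV _ hx
  have hR := hS.restrict_invariant hU
  let b := hR.eigenvectorBasis rfl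
  refine ⟨_, fun i => e (b i : EuclideanSpace ℂ (Fin L → Fin 2)), hR.eigenvalues rfl,
    fun i => (b i).2, fun i j => ?_, fun i => ?_, ?_⟩
  · rw [← hin, ← Submodule.coe_inner]
    exact orthonormal_iff_ite.1 b.orthonormal i j
  · have h := congrArg Subtype.val (hR.apply_eigenvectorBasis rfl i)
    exact congrArg e h
  · intro f hf
    let x : U := ⟨e.symm f, by simpa [U] using hf⟩
    have h := congrArg (fun y : U => e (y : EuclideanSpace ℂ (Fin L → Fin 2))) (b.sum_repr x)
    simp only [Submodule.coe_sum, Submodule.coe_smul, map_sum, map_smul] at h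
    have hx : e (x : EuclideanSpace ℂ (Fin L → Fin 2)) = f := e.apply_symm_apply f
    rw [← hx, ← h]
    exact Submodule.sum_mem _ fun i _ => Submodule.smul_mem _ _ (Submodule.subset_span ⟨i, rfl⟩)

theorem exists_isGround {L : ℕ} {T : Wave L →ₗ[ℂ] Wave L}
    (hT : ∀ f g, star (T f) ⬝ᵥ g = star f ⬝ᵥ T g) {V : Submodule ℂ (Wave L)}
    (hV : ∀ f ∈ V, T f ∈ V) (hV0 : V ≠ ⊥) : ∃ t, IsGround T V t := by
  obtain ⟨n, v, μ, hv, ho, hμ, hs⟩ := exists_eigenbasis hT hV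
  have hn : Nonempty (Fin n) := by
    by_contra h
    rw [not_nonempty_iff] at h
    rw [Set.range_eq_empty, Submodule.span_empty] at hs
    exact hV0 (le_bot_iff.1 hs)
  obtain ⟨i, hi⟩ := Finite.exists_min μ
  refine ⟨μ i, ⟨v i, hv i, ?_, hμ i⟩, fun f hf => ?_⟩
  · intro h
    have := ho i i
    rw [h] at this
    simp at this
  · obtain ⟨c, rfl⟩ := (Submodule.mem_span_range_iff_exists_fun ℂ).1 (hs hf)
    have h1 (a : Fin n → ℂ) : star (∑ j, c j • v j) ⬝ᵥ ∑ j, a j • v j = ∑ j, star (c j) * a j := by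
      simp only [star_sum, star_smul, sum_dotProduct, dotProduct_sum, smul_dotProduct,
        dotProduct_smul, ho]
      simp [mul_comm]
    have h2 : T (∑ j, c j • v j) = ∑ j, (c j * μ j) • v j := by
      simp only [map_sum, map_smul, hμ, smul_smul]
    rw [h2, h1, h1, Complex.re_sum, Complex.re_sum, Finset.mul_sum]
    refine Finset.sum_le_sum fun j _ => ?_
    have h3 : star (c j) * c j = (Complex.normSq (c j) : ℂ) :=
      (Complex.normSq_eq_conj_mul_self).symm
    rw [← mul_assoc, h3, ← Complex.ofReal_mul, Complex.ofReal_re, Complex.ofReal_re, mul_comm]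
    exact mul_le_mul_of_nonneg_left (hi j) (Complex.normSq_nonneg _)

theorem ham_mem_highest {Δ : ℝ} (hΔ : 1 ≤ Δ) {L : ℕ} {d : ℤ} {f : Wave L}
    (hf : f ∈ highest (qParam Δ) L d) : ham Δ L f ∈ highest (qParam Δ) L d := by
  refine ⟨by rw [raise_ham hΔ, hf.1, map_zero], ?_⟩
  rw [IsWeight, spinZ_ham hΔ, hf.2, map_smul]

theorem exists_pattern (q : ℝ) (d n : ℕ) : ∃ f, Pattern q d (d + 2 * n) f := by
  induction n with
  | zero => exact ⟨_, Pattern.up⟩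
  | succ n ih =>
    obtain ⟨f, hf⟩ := ih
    exact ⟨_, hf.ins (Nat.zero_le _)⟩

theorem exists_isGround_highest {Δ : ℝ} (hΔ : 1 ≤ Δ) {L d : ℕ} (n : ℕ) (hL : L = d + 2 * n) :
    ∃ t, IsGround (ham Δ L) (highest (qParam Δ) L d) t := by
  obtain ⟨hq, hq1, -⟩ := qParam_spec hΔ
  refine exists_isGround (ham_symm hΔ) (fun f => ham_mem_highest hΔ) ?_
  subst hL
  obtain ⟨f, hf⟩ := exists_pattern (qParam Δ) d n
  exact (Submodule.ne_bot_iff _).2 ⟨f, hf.mem_highest hq, hf.ne_zero hq1⟩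

/-! ### Adding a site does not raise the ground state energy -/

/-- The powers of `A` on `f` grow at most like those of the number `r`. -/
def GrowthLE {L : ℕ} (A : Module.End ℂ (Wave L)) (r : ℝ) (f : Wave L) : Prop :=
  ∃ C : ℝ, ∀ k : ℕ, ‖(A ^ k) f‖ ≤ C * r ^ k

theorem growthLE_of_mem_span {L : ℕ} {A : Module.End ℂ (Wave L)} {r : ℝ} {s : Set (Wave L)}
    (hs : ∀ f ∈ s, GrowthLE A r f) {f : Wave L} (hf : f ∈ Submodule.span ℂ s) :
    GrowthLE A r f := by
  refine Submodule.span_induction (p := fun f _ => GrowthLE A r f) hs ?_ ?_ ?_ hf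
  · exact ⟨0, fun k => by simp⟩
  · rintro x y _ _ ⟨C, hC⟩ ⟨D, hD⟩
    refine ⟨C + D, fun k => ?_⟩
    rw [map_add, add_mul]
    exact (norm_add_le _ _).trans (add_le_add (hC k) (hD k))
  · rintro c x _ ⟨C, hC⟩
    refine ⟨‖c‖ * C, fun k => ?_⟩
    rw [map_smul, norm_smul, mul_assoc]
    exact mul_le_mul_of_nonneg_left (hC k) (norm_nonneg _)

/-- The operator `c - H`. -/
def shiftedHam (Δ c : ℝ) (L : ℕ) : Module.End ℂ (Wave L) :=
  (c : ℂ) • LinearMap.id - ham Δ L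

theorem shiftedHam_apply {Δ c : ℝ} {L : ℕ} (f : Wave L) :
    shiftedHam Δ c L f = (c : ℂ) • f - ham Δ L f := rfl

theorem shiftedHam_pow_apply {Δ c t : ℝ} {L : ℕ} {f : Wave L} (hf : ham Δ L f = (t : ℂ) • f)
    (k : ℕ) : (shiftedHam Δ c L ^ k) f = (((c - t) ^ k : ℝ) : ℂ) • f := by
  induction k with
  | zero => simp
  | succ k ih =>
    rw [pow_succ', Module.End.mul_apply, ih, map_smul, shiftedHam_apply, hf, ← sub_smul, smul_smul]
    congr 1
    push_cast
    ring

theorem growthLE_highest {Δ : ℝ} (hΔ : 1 ≤ Δ) {L : ℕ} {d : ℤ} {t : ℝ}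
    (ht : IsGround (ham Δ L) (highest (qParam Δ) L d) t) :
    ∃ c₀ : ℝ, ∀ c, c₀ ≤ c → ∀ f ∈ highest (qParam Δ) L d,
      GrowthLE (shiftedHam Δ c L) (c - t) f := by
  obtain ⟨n, v, μ, hv, ho, hμ, hs⟩ := exists_eigenbasis (ham_symm hΔ)
    (V := highest (qParam Δ) L d) (fun f => ham_mem_highest hΔ)
  obtain ⟨c₀, hc₀⟩ := (Set.finite_range μ).bddAbove
  refine ⟨c₀, fun c hc f hf => growthLE_of_mem_span ?_ (hs hf)⟩
  rintro _ ⟨i, rfl⟩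
  refine ⟨‖v i‖, fun k => ?_⟩
  have h0 : v i ≠ 0 := by
    intro h
    have := ho i i
    rw [h] at this
    simp at this
  have h1 : 0 ≤ c - μ i := sub_nonneg.2 ((hc₀ ⟨i, rfl⟩).trans hc)
  rw [shiftedHam_pow_apply (hμ i), norm_smul, Complex.norm_real,
    Real.norm_of_nonneg (by positivity), mul_comm]
  refine mul_le_mul_of_nonneg_left (pow_le_pow_left₀ h1 ?_ k) (norm_nonneg _)
  exact sub_le_sub_left (ht.le (hv i) h0 (hμ i)) c

theorem ham_prependUp {Δ : ℝ} (hΔ : 1 ≤ Δ) {L : ℕ} (f : Wave (L + 1)) :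
    ham Δ (L + 2) (prependUp f) =
      singletProj (qParam Δ) 0 L (prependUp f) + prependUp (ham Δ (L + 1) f) := by
  refine wave_ext fun a => ?_
  rw [slice_ham hΔ, map_add]
  fin_cases a <;> simp

theorem shiftedHam_pow_mem {Δ : ℝ} (hΔ : 1 ≤ Δ) {d L : ℕ} {c : ℝ} (hc : L ≤ c) {f : Wave L}
    (hf : f ∈ cone (qParam Δ) d L) (k : ℕ) :
    (shiftedHam Δ c L ^ k) f ∈ cone (qParam Δ) d L := by
  induction k with
  | zero => exact hf
  | succ k ih =>
    rw [pow_succ', Module.End.mul_apply]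
    exact sub_ham_mem hΔ hc ih

/-- The evolution of `↑ ⊗ f` under `c - H` dominates the evolution of `f`, in the order defined by
the cone of patterns: the additional interaction contributes only nonnegatively. -/
theorem shiftedHam_pow_prependUp_mem {Δ : ℝ} (hΔ : 1 ≤ Δ) {d L : ℕ} {c : ℝ}
    (hc : ((L + 2 : ℕ) : ℝ) ≤ c) {f : Wave (L + 1)} (hf : f ∈ cone (qParam Δ) d (L + 1)) (k : ℕ) :
    (shiftedHam Δ c (L + 2) ^ k) (prependUp f) - prependUp ((shiftedHam Δ c (L + 1) ^ k) f) ∈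
      cone (qParam Δ) (d + 1) (L + 2) := by
  have hc' : ((L + 1 : ℕ) : ℝ) ≤ c := le_trans (by exact_mod_cast Nat.le_succ _) hc
  induction k with
  | zero =>
    simp
  | succ k ih =>
    rw [pow_succ', pow_succ', Module.End.mul_apply, Module.End.mul_apply]
    have h1 := neg_singletProj_prependUp_mem (qParam_spec hΔ).1 (shiftedHam_pow_mem hΔ hc' hf k)
    set g := (shiftedHam Δ c (L + 1) ^ k) f
    have h2 := sub_ham_mem hΔ hc ih
    convert add_mem h2 h1 using 1
    rw [shiftedHam_apply, shiftedHam_apply, map_sub, map_sub, map_smul, ham_prependUp hΔ]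
    module

/-- By positivity in the basis of patterns, adding an up spin does not raise the ground state
energy. -/
theorem ground_succ_le {Δ : ℝ} (hΔ : 1 ≤ Δ) {L d : ℕ} {t s : ℝ}
    (ht : IsGround (ham Δ (L + 1)) (highest (qParam Δ) (L + 1) d) t)
    (hs : IsGround (ham Δ (L + 2)) (highest (qParam Δ) (L + 2) (d + 1 : ℕ)) s) : s ≤ t := by
  obtain ⟨hq, hq1, -⟩ := qParam_spec hΔ
  obtain ⟨c₀, hc₀⟩ := growthLE_highest hΔ hs
  -- Large enough for `c - H` to preserve the cones and to have largest eigenvalue `c - s > 0`.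
  obtain ⟨c, hc⟩ : ∃ c, max (max c₀ (L + 2 : ℕ)) (s + 1) ≤ c := ⟨_, le_rfl⟩
  have hc1 : c₀ ≤ c := ((le_max_left _ _).trans (le_max_left _ _)).trans hc
  have hc2 : ((L + 2 : ℕ) : ℝ) ≤ c := ((le_max_right _ _).trans (le_max_left _ _)).trans hc
  have hc3 : 0 < c - s := by linarith [(le_max_right _ _).trans hc]
  have hc' : ((L + 1 : ℕ) : ℝ) ≤ c := le_trans (by exact_mod_cast Nat.le_succ _) hc2
  -- The functional with parameters `b` restricts on states `↑ ⊗ f` to the one with the shifted `b`.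
  let b : ℕ → ℝ := fun i => i
  have hb : StrictMono b := Nat.strictMono_cast
  have hb0 : ∀ i, 0 ≤ b i := fun i => Nat.cast_nonneg i
  have hb' : StrictMono fun i => b (i + 1) := fun i j h => hb (Nat.succ_lt_succ h)
  have hb0' : ∀ i, 0 ≤ b (i + 1) := fun i => hb0 _
  obtain ⟨C, hC⟩ := exists_norm_le_pairing hq1 d (L + 1) hb' hb0'
  have key : ∀ f, Pattern (qParam Δ) d (L + 1) f →
      GrowthLE (shiftedHam Δ c (L + 1)) (c - s) f := by
    intro f hf
    obtain ⟨D, hD⟩ := hc₀ c hc1 _ (hf.prependUp.mem_highest hq)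
    let N := ‖LinearMap.toContinuousLinearMap (pairing (L + 2) b)‖
    refine ⟨|C| * (N * D), fun k => ?_⟩
    have h1 := shiftedHam_pow_mem hΔ hc' hf.mem_cone k
    have h2 := shiftedHam_pow_prependUp_mem hΔ hc2 hf.mem_cone k
    obtain ⟨r, hr, hr'⟩ := pairing_nonneg hq1 h1 hb' hb0'
    obtain ⟨r', hr0, hr0'⟩ := pairing_nonneg hq1 h2 hb hb0
    have h3 := hC _ h1
    rw [hr', Complex.ofReal_re] at h3
    rw [map_sub, pairing_succ (L := L + 1) b (XXZ.prependUp _), slice_zero_prependUp,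
      slice_one_prependUp, map_zero, mul_zero, add_zero, hr', sub_eq_iff_eq_add,
      ← Complex.ofReal_add] at hr0'
    have h4 : r' + r ≤ N * ‖(shiftedHam Δ c (L + 2) ^ k) (prependUp f)‖ := by
      have h5 := (LinearMap.toContinuousLinearMap (pairing (L + 2) b)).le_opNorm
        ((shiftedHam Δ c (L + 2) ^ k) (prependUp f))
      rw [LinearMap.coe_toContinuousLinearMap', hr0', Complex.norm_real,
        Real.norm_of_nonneg (by positivity)] at h5
      exact h5
    calc _ ≤ C * r := h3
      _ ≤ |C| * (r' + r) := mul_le_mul (le_abs_self C) (by linarith) hr (abs_nonneg C)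
      _ ≤ |C| * (N * (D * (c - s) ^ k)) := by
        refine mul_le_mul_of_nonneg_left (h4.trans ?_) (abs_nonneg C)
        exact mul_le_mul_of_nonneg_left (hD k) (norm_nonneg _)
      _ = _ := by ring
  obtain ⟨φ, hφ, hφ0, hφt⟩ := ht.1
  have hφs : φ ∈ Submodule.span ℂ {f | Pattern (qParam Δ) d (L + 1) f} := by
    refine Submodule.span_mono ?_ (highest_le hq _ _ hφ)
    rintro f ⟨k, hk, hf⟩
    obtain rfl : k = d := by exact_mod_cast hk
    exact hf
  obtain ⟨D, hD⟩ := growthLE_of_mem_span key hφs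
  by_contra! hlt
  have hφn : 0 < ‖φ‖ := norm_pos_iff.2 hφ0
  obtain ⟨k, hk⟩ := pow_unbounded_of_one_lt (D / ‖φ‖)
    ((one_lt_div hc3).2 (sub_lt_sub_left hlt c))
  have h := hD k
  have hct : 0 < c - t := by linarith
  rw [shiftedHam_pow_apply hφt, norm_smul, Complex.norm_real,
    Real.norm_of_nonneg (by positivity)] at h
  rw [div_pow, div_lt_div_iff₀ hφn (by positivity)] at hk
  exact absurd h (not_le.2 hk)

/-! ### The ground state energy is strictly monotone in the weight -/

/-- The Hamiltonian without the interaction of the first two sites. -/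
def tailHam (Δ : ℝ) (L : ℕ) : Wave (L + 2) →ₗ[ℂ] Wave (L + 2) :=
  glue fun a => ham Δ (L + 1) ∘ₗ slice (L := L + 1) a

theorem slice_tailHam {Δ : ℝ} {L : ℕ} (f : Wave (L + 2)) (a : Fin 2) :
    slice (L := L + 1) a (tailHam Δ L f) = ham Δ (L + 1) (slice (L := L + 1) a f) := by
  simp [tailHam]

theorem ham_eq_add_tailHam {Δ : ℝ} (hΔ : 1 ≤ Δ) {L : ℕ} (f : Wave (L + 2)) :
    ham Δ (L + 2) f = singletProj (qParam Δ) 0 L f + tailHam Δ L f := by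
  refine wave_ext fun a => ?_
  rw [slice_ham hΔ, map_add, slice_tailHam]

theorem tailHam_symm {Δ : ℝ} (hΔ : 1 ≤ Δ) {L : ℕ} (f g : Wave (L + 2)) :
    star (tailHam Δ L f) ⬝ᵥ g = star f ⬝ᵥ tailHam Δ L g := by
  rw [inner_succ (L := L + 1), inner_succ (L := L + 1)]
  simp only [slice_tailHam, ham_symm hΔ]

theorem tailHam_mem_highest {Δ : ℝ} (hΔ : 1 ≤ Δ) {L : ℕ} {d : ℤ} {f : Wave (L + 2)}
    (hf : f ∈ highest (qParam Δ) (L + 2) d) : tailHam Δ L f ∈ highest (qParam Δ) (L + 2) d := by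
  have hq := (qParam_spec hΔ).1
  refine ⟨?_, ?_⟩
  · have h : raise (qParam Δ) (L + 2) (tailHam Δ L f) =
        tailHam Δ L (raise (qParam Δ) (L + 2) f) := by
      refine wave_ext fun a => ?_
      rw [slice_raise hq (L := L + 1), slice_tailHam, slice_tailHam, slice_tailHam,
        slice_raise hq (L := L + 1), raise_ham hΔ, map_add, map_smul,
        apply_ite (ham Δ (L + 1)), map_zero]
    rw [h, hf.1, map_zero]
  · have h : spinZ (L + 2) (tailHam Δ L f) = tailHam Δ L (spinZ (L + 2) f) := by
      refine wave_ext fun a => ?_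
      rw [slice_spinZ (L := L + 1), slice_tailHam, slice_tailHam,
        slice_spinZ (L := L + 1), spinZ_ham hΔ, map_add, map_smul]
    rw [IsWeight, h, hf.2, map_smul]

/-- By the Temperley–Lieb relations an eigenvector of the Hamiltonian that is annihilated by the
first interaction is annihilated by all of them. -/
theorem contr_eq_zero_of_eigenvector {Δ : ℝ} (hΔ : 1 ≤ Δ) {L : ℕ} {f : Wave (L + 2)} {t : ℂ}
    (hf : ham Δ (L + 2) f = t • f) (h0 : contr (qParam Δ) 0 L f = 0) {x : ℕ} (hx : x ≤ L) :
    contr (qParam Δ) x L f = 0 := by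
  have hq := (qParam_spec hΔ).1
  set q := qParam Δ with hqdef
  have hq' : -(q : ℂ) ≠ 0 := by exact_mod_cast neg_ne_zero.2 hq.ne'
  have hne : (1 + (q : ℂ) ^ 2)⁻¹ ≠ 0 := by
    have : (0 : ℝ) < 1 + q ^ 2 := by positivity
    exact inv_ne_zero (by exact_mod_cast this.ne')
  induction x using Nat.strong_induction_on with
  | _ x ih =>
    cases x with
    | zero => exact h0
    | succ x =>
      have hxx : contr q x L f = 0 := ih x (by omega) (by omega)
      have h := congrArg (contr q x L) hf
      rw [ham_eq_sum hΔ, map_sum, map_smul, hxx, smul_zero,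
        Finset.sum_eq_single_of_mem (x + 1) (Finset.mem_range.2 (by omega)) ?_,
        singletProj_apply, map_smul, contr_ins_succ _ hx] at h
      · exact (smul_eq_zero.1 ((smul_eq_zero.1 h).resolve_left hne)).resolve_left hq'
      · intro y hy hyx
        rw [Finset.mem_range] at hy
        rw [singletProj_apply, map_smul]
        rcases Nat.lt_or_ge y (x + 1) with hlt | hge
        · rw [← hqdef, ih y hlt (by omega), map_zero, map_zero, smul_zero]
        · obtain ⟨z, rfl⟩ : ∃ z, y = z + 2 := ⟨y - 2, by omega⟩
          obtain ⟨K, rfl⟩ : ∃ K, L = K + 2 := ⟨L - 2, by omega⟩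
          rw [contr_ins_add_two _ (by omega), contr_contr _ (by omega), hxx, map_zero, map_zero,
            smul_zero]

/-- Below maximal spin no highest weight vector is annihilated by all interactions, since every
pattern then contains a singlet of neighbouring sites. -/
theorem eq_zero_of_contr_eq_zero {q : ℝ} (hq : 0 < q) {L d : ℕ} (hd : d ≤ L) {f : Wave (L + 2)}
    (hf : f ∈ highest q (L + 2) d) (h : ∀ x ≤ L, contr q x L f = 0) : f = 0 := by
  rw [← inner_self_eq_zero_iff]
  refine Submodule.span_induction (p := fun g _ => star g ⬝ᵥ f = 0) ?_ ?_ ?_ ?_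
    (highest_le hq _ _ hf)
  · rintro p ⟨k, hk, hp⟩
    obtain rfl : k = d := by exact_mod_cast hk
    cases hp with
    | up => omega
    | ins hx hg => rw [inner_ins, h _ hx, dotProduct_zero]
  · rw [star_zero, zero_dotProduct]
  · intro x y _ _ hx hy
    rw [star_add, add_dotProduct, hx, hy, add_zero]
  · intro c x _ hx
    rw [star_smul, smul_dotProduct, hx, smul_zero]

theorem inner_singletProj_pos {q : ℝ} {x L : ℕ} {f : Wave (L + 2)} (h : contr q x L f ≠ 0) :
    0 < (star f ⬝ᵥ singletProj q x L f).re := by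
  have hc : (1 + (q : ℂ) ^ 2)⁻¹ = (((1 + q ^ 2)⁻¹ : ℝ) : ℂ) := by push_cast; rfl
  rw [inner_singletProj, hc, Complex.re_ofReal_mul]
  exact mul_pos (by positivity) (inner_self_pos h)

/-- The ordering of the ground state energies of highest weight vectors. The component of an
eigenvector of `tailHam` with first spin down is a highest weight vector of weight `d + 1` of the
shorter chain, and, if it vanishes, the component with first spin up is one of weight `d - 1`. -/
theorem ground_lt {Δ : ℝ} (hΔ : 1 ≤ Δ) (L : ℕ) {d n : ℕ} (hL : L = d + 2 * n) {t s : ℝ}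
    (ht : IsGround (ham Δ (L + 2)) (highest (qParam Δ) (L + 2) d) t)
    (hs : IsGround (ham Δ (L + 2)) (highest (qParam Δ) (L + 2) (d + 2 : ℕ)) s) : s < t := by
  have hq := (qParam_spec hΔ).1
  induction L using Nat.strong_induction_on generalizing d n t s with
  | _ L ih =>
    obtain ⟨r, hr⟩ := exists_isGround_highest hΔ (L := L + 1) (d := d + 1) n (by omega)
    have hsr : s ≤ r := ground_succ_le hΔ hr hs
    obtain ⟨ψ, hψ, hψ0, hψt⟩ := ht.1
    obtain ⟨u, hu⟩ := exists_isGround (tailHam_symm hΔ) (fun f => tailHam_mem_highest hΔ)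
      ((Submodule.ne_bot_iff _).2 ⟨ψ, hψ, hψ0⟩)
    have hru : r ≤ u := by
      obtain ⟨χ, hχ, hχ0, hχu⟩ := hu.1
      have hslice (a : Fin 2) : ham Δ (L + 1) (slice (L := L + 1) a χ) =
          (u : ℂ) • slice (L := L + 1) a χ := by
        rw [← slice_tailHam, hχu, map_smul]
      by_cases h1 : slice (L := L + 1) 1 χ = 0
      · have h0 : slice (L := L + 1) 0 χ ≠ 0 := by
          intro h0
          refine hχ0 (wave_ext (L := L + 1) fun a => ?_)
          fin_cases a
          · exact h0.trans (map_zero _).symm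
          · exact h1.trans (map_zero _).symm
        have hmem := slice_zero_mem (L := L + 1) hq hχ h1
        cases d with
        | zero =>
          rw [highest_of_neg hq (by simp)] at hmem
          exact absurd hmem h0
        | succ d =>
          obtain ⟨K, rfl⟩ : ∃ K, L = K + 1 := ⟨L - 1, by omega⟩
          have hd : ((d + 1 : ℕ) : ℤ) - 1 = (d : ℕ) := by push_cast; ring
          rw [hd] at hmem
          obtain ⟨w, hw⟩ := exists_isGround_highest hΔ (L := K + 2) (d := d) (n + 1) (by omega)
          exact (ih K (by omega) (d := d) (n := n) (by omega) hw hr).le.trans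
            (hw.le hmem h0 (hslice 0))
      · have hmem := slice_one_mem (L := L + 1) hq hχ
        rw [← Nat.cast_succ] at hmem
        exact hr.le hmem h1 (hslice 1)
    by_contra! hts
    -- In the case of equality the interaction of the first two sites vanishes on `ψ`.
    have h0 : contr (qParam Δ) 0 L ψ = 0 := by
      by_contra h0
      have h1 := hu.2 ψ hψ
      have h2 : (star ψ ⬝ᵥ ham Δ (L + 2) ψ).re = t * (star ψ ⬝ᵥ ψ).re := by
        rw [hψt, dotProduct_smul, smul_eq_mul, Complex.re_ofReal_mul]
      rw [ham_eq_add_tailHam hΔ, dotProduct_add, Complex.add_re] at h2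
      have h3 := inner_singletProj_pos h0
      have h4 := mul_le_mul_of_nonneg_right ((hts.trans hsr).trans hru) (inner_self_nonneg ψ)
      linarith
    exact hψ0 (eq_zero_of_contr_eq_zero hq (by omega) hψ fun x hx =>
      contr_eq_zero_of_eigenvector hΔ hψt h0 hx)

/-! ### Irreducible representations -/

theorem inner_spinZ {L : ℕ} (f g : Wave L) : star (spinZ L f) ⬝ᵥ g = star f ⬝ᵥ spinZ L g := by
  simp only [dotProduct, Pi.star_apply, spinZ_coord]
  refine Finset.sum_congr rfl fun σ _ => ?_
  simp
  ring

theorem inner_eq_zero_of_weight_ne {L : ℕ} {d m : ℤ} {f g : Wave L} (hf : IsWeight d f)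
    (hg : IsWeight m g) (h : d ≠ m) : star f ⬝ᵥ g = 0 := by
  refine Finset.sum_eq_zero fun σ _ => ?_
  by_contra h0
  rw [mul_eq_zero, not_or, Pi.star_apply, star_eq_zero] at h0
  exact h ((hf.sum_eq h0.1).symm.trans (hg.sum_eq h0.2))

/-- Highest weight vectors are orthogonal to the range of the lowering operator. -/
theorem inner_lower_of_mem_highest {q : ℝ} (hq : 0 < q) {L : ℕ} {d : ℤ} {f : Wave L}
    (hf : f ∈ highest q L d) (g : Wave L) : star f ⬝ᵥ lower q L g = 0 := by
  have h := inner_lower hq f g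
  rw [hf.1, star_zero, zero_dotProduct, mul_zero, hf.2.weightPow_eq, star_smul,
    smul_dotProduct] at h
  refine (smul_eq_zero.1 h).resolve_left ?_
  refine star_ne_zero.2 ?_
  exact_mod_cast (zpow_pos hq _).ne'

theorem exists_weight_vector {L : ℕ} {V : Submodule ℂ (Wave L)} (hz : ∀ f ∈ V, spinZ L f ∈ V)
    (hV : V ≠ ⊥) : ∃ d : ℤ, ∃ f ∈ V, f ≠ 0 ∧ IsWeight d f := by
  obtain ⟨t, ⟨f, hf, hf0, ht⟩, -⟩ := exists_isGround inner_spinZ hz hV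
  obtain ⟨σ, hσ⟩ := Function.ne_iff.1 hf0
  refine ⟨∑ y, twoSz (σ y), f, hf, hf0, ?_⟩
  have h := congrFun ht σ
  rw [spinZ_coord, Pi.smul_apply, smul_eq_mul] at h
  rw [IsWeight, ht, mul_right_cancel₀ hσ h]

/-- Repeated raising of a weight vector ends at a highest weight vector, since the weights are
bounded. -/
theorem exists_mem_highest {q : ℝ} (hq : 0 < q) {L : ℕ} {V : Submodule ℂ (Wave L)}
    (hz : ∀ f ∈ V, spinZ L f ∈ V) (hr : ∀ f ∈ V, raise q L f ∈ V) (hV : V ≠ ⊥) :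
    ∃ d : ℤ, ∃ f ∈ V, f ≠ 0 ∧ f ∈ highest q L d := by
  obtain ⟨d, f, hf, hf0, hd⟩ := exists_weight_vector hz hV
  obtain ⟨k, hk⟩ : ∃ k : ℕ, (L : ℤ) - d ≤ k := ⟨((L : ℤ) - d).toNat, Int.self_le_toNat _⟩
  induction k generalizing d f with
  | zero =>
    refine ⟨d, f, hf, hf0, ?_, hd⟩
    by_contra h
    have := (hd.raise hq).le h
    push_cast at hk
    omega
  | succ k ih =>
    by_cases h : raise q L f = 0
    · exact ⟨d, f, hf, hf0, h, hd⟩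
    · refine ih (d + 2) _ (hr f hf) h (hd.raise hq) ?_
      push_cast at hk
      omega

theorem qInt_mul_add {q : ℝ} (hq : 0 < q) (a b : ℤ) :
    qInt q a * qInt q b + qInt q (b - 1 - a) = qInt q (a + 1) * qInt q (b - 1) := by
  unfold qInt
  split_ifs with h
  · push_cast
    ring
  · have hne := sub_inv_ne_zero hq h
    rw [div_mul_div_comm, div_mul_div_comm, div_add_div _ _ (mul_ne_zero hne hne) hne,
      div_eq_div_iff (mul_ne_zero (mul_ne_zero hne hne) hne) (mul_ne_zero hne hne)]
    simp only [_root_.zpow_neg, zpow_add₀ hq.ne', zpow_sub₀ hq.ne', zpow_one]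
    field_simp
    ring

theorem lower_iterate_weight {q : ℝ} {L : ℕ} {d : ℤ} {f : Wave L} (hf : IsWeight d f) (k : ℕ) :
    IsWeight (d - 2 * k) ((lower q L)^[k] f) := by
  induction k with
  | zero => simpa using hf
  | succ k ih =>
    rw [Function.iterate_succ_apply']
    convert ih.lower using 1
    push_cast
    ring

/-- The raising operator takes each lowered highest weight vector back by one step, with a factor
that is nonzero for `k < d` and vanishes for `k = d`. -/
theorem raise_lower_iterate {q : ℝ} (hq : 0 < q) {L : ℕ} {d : ℤ} {f : Wave L}
    (hf : f ∈ highest q L d) (k : ℕ) :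
    raise q L ((lower q L)^[k + 1] f) =
      ((qInt q (k + 1) * qInt q (d - k) : ℝ) : ℂ) • (lower q L)^[k] f := by
  induction k with
  | zero =>
    have h1 : qInt q 1 = 1 := by
      have := qInt_add_one hq 0
      rw [qInt_zero] at this
      simpa using this
    have h := raise_lower_sub hq hf.2
    rw [hf.1, map_zero, sub_zero] at h
    simp [h, h1]
  | succ k ih =>
    have h := raise_lower_sub hq (lower_iterate_weight (q := q) hf.2 (k + 1))
    rw [ih, map_smul, ← Function.iterate_succ_apply' (lower q L),
      ← Function.iterate_succ_apply' (lower q L),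
      sub_eq_iff_eq_add, ← add_smul, ← Complex.ofReal_add] at h
    rw [h]
    congr 2
    have h2 := qInt_mul_add hq (k + 1) (d - k)
    rw [add_comm, show d - 2 * ((k + 1 : ℕ) : ℤ) = d - k - 1 - (k + 1) by push_cast; ring, h2]
    congr 2
    push_cast
    ring

theorem lower_iterate_ne_zero {q : ℝ} (hq : 0 < q) {L d : ℕ} {f : Wave L}
    (hf : f ∈ highest q L d) (hf0 : f ≠ 0) {k : ℕ} (hk : k ≤ d) : (lower q L)^[k] f ≠ 0 := by
  induction k with
  | zero => exact hf0
  | succ k ih =>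
    intro h
    have h1 := raise_lower_iterate hq hf k
    rw [h, map_zero, eq_comm] at h1
    have h2 := (smul_eq_zero.1 h1).resolve_right (ih (by omega))
    rw [Complex.ofReal_eq_zero] at h2
    obtain ⟨j, hj⟩ : ∃ j : ℕ, (d : ℤ) - k = j + 1 := ⟨d - k - 1, by omega⟩
    rw [hj] at h2
    exact (mul_pos (qInt_pos hq k) (qInt_pos hq j)).ne' h2

theorem lower_iterate_eq_zero {q : ℝ} (hq : 0 < q) {L d : ℕ} {f : Wave L}
    (hf : f ∈ highest q L d) {k : ℕ} (hk : d < k) : (lower q L)^[k] f = 0 := by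
  obtain ⟨j, rfl⟩ : ∃ j, k = j + (d + 1) := ⟨k - (d + 1), by omega⟩
  have h : (lower q L)^[d + 1] f ∈ highest q L ((d : ℤ) - 2 * (d + 1 : ℕ)) := by
    refine ⟨?_, lower_iterate_weight hf.2 _⟩
    rw [raise_lower_iterate hq hf, sub_self, qInt_zero]
    simp
  rw [highest_of_neg hq (by push_cast; omega), Submodule.mem_bot] at h
  rw [Function.iterate_add_apply, h]
  exact iterate_map_zero (lower q L) j

/-- The span of the vectors obtained from `f` by repeated lowering. -/
def ladder (q : ℝ) {L : ℕ} (f : Wave L) : Submodule ℂ (Wave L) :=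
  Submodule.span ℂ (Set.range fun k : ℕ => (lower q L)^[k] f)

theorem mem_ladder {q : ℝ} {L : ℕ} (f : Wave L) (k : ℕ) : (lower q L)^[k] f ∈ ladder q f :=
  Submodule.subset_span ⟨k, rfl⟩

theorem self_mem_ladder {q : ℝ} {L : ℕ} (f : Wave L) : f ∈ ladder q f := mem_ladder f 0

theorem ladder_le {q : ℝ} {L : ℕ} {f : Wave L} {V : Submodule ℂ (Wave L)} (hf : f ∈ V)
    (hV : ∀ g ∈ V, lower q L g ∈ V) : ladder q f ≤ V := by
  refine Submodule.span_le.2 ?_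
  rintro _ ⟨k, rfl⟩
  induction k with
  | zero => exact hf
  | succ k ih =>
    simp only [Function.iterate_succ_apply'] at ih ⊢
    exact hV _ ih

/-- The subspace `V` is stable under the generators of the quantum group. -/
def IsStable (q : ℝ) {L : ℕ} (V : Submodule ℂ (Wave L)) : Prop :=
  ∀ f ∈ V, spinZ L f ∈ V ∧ raise q L f ∈ V ∧ lower q L f ∈ V

theorem isStable_span {q : ℝ} {L : ℕ} {s : Set (Wave L)}
    (h : ∀ f ∈ s, spinZ L f ∈ Submodule.span ℂ s ∧ raise q L f ∈ Submodule.span ℂ s ∧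
      lower q L f ∈ Submodule.span ℂ s) : IsStable q (Submodule.span ℂ s) := by
  have key (T : Wave L →ₗ[ℂ] Wave L) (hT : ∀ f ∈ s, T f ∈ Submodule.span ℂ s) :
      ∀ f ∈ Submodule.span ℂ s, T f ∈ Submodule.span ℂ s := by
    intro f hf
    exact (Submodule.span_le (p := (Submodule.span ℂ s).comap T)).2 hT hf
  exact fun f hf => ⟨key _ (fun g hg => (h g hg).1) f hf, key _ (fun g hg => (h g hg).2.1) f hf,
    key _ (fun g hg => (h g hg).2.2) f hf⟩

theorem lower_iterate_stable {q : ℝ} (hq : 0 < q) {L : ℕ} {d : ℤ} {f : Wave L}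
    (hf : f ∈ highest q L d) (k : ℕ) :
    spinZ L ((lower q L)^[k] f) ∈ ladder q f ∧ raise q L ((lower q L)^[k] f) ∈ ladder q f ∧
      lower q L ((lower q L)^[k] f) ∈ ladder q f := by
  refine ⟨?_, ?_, ?_⟩
  · rw [lower_iterate_weight hf.2 k]
    exact Submodule.smul_mem _ _ (mem_ladder f k)
  · cases k with
    | zero =>
      rw [Function.iterate_zero_apply, hf.1]
      exact zero_mem _
    | succ k =>
      rw [raise_lower_iterate hq hf]
      exact Submodule.smul_mem _ _ (mem_ladder f k)
  · rw [← Function.iterate_succ_apply' (lower q L)]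
    exact mem_ladder f (k + 1)

theorem ladder_isStable {q : ℝ} (hq : 0 < q) {L : ℕ} {d : ℤ} {f : Wave L}
    (hf : f ∈ highest q L d) : IsStable q (ladder q f) := by
  refine isStable_span ?_
  rintro _ ⟨k, rfl⟩
  exact lower_iterate_stable hq hf k

theorem finrank_ladder {q : ℝ} (hq : 0 < q) {L d : ℕ} {f : Wave L} (hf : f ∈ highest q L d)
    (hf0 : f ≠ 0) : Module.finrank ℂ (ladder q f) = d + 1 := by
  have hli : LinearIndependent ℂ fun k : Fin (d + 1) => (lower q L)^[(k : ℕ)] f := by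
    refine Module.End.eigenvectors_linearIndependent' (spinZ L)
      (fun k : Fin (d + 1) => ((((d : ℤ) - 2 * ((k : ℕ) : ℤ) : ℤ) : ℂ) / 2)) ?_ _ fun k => ?_
    · intro i j hij
      have h : (((d : ℤ) - 2 * ((i : ℕ) : ℤ) : ℤ) : ℂ) =
          (((d : ℤ) - 2 * ((j : ℕ) : ℤ) : ℤ) : ℂ) := by
        simpa using hij
      rw [Int.cast_inj] at h
      exact Fin.ext (by omega)
    · exact ⟨Module.End.mem_eigenspace_iff.2 (lower_iterate_weight hf.2 k),
        lower_iterate_ne_zero hq hf hf0 (Nat.lt_succ_iff.1 k.2)⟩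
  have hspan : ladder q f =
      Submodule.span ℂ (Set.range fun k : Fin (d + 1) => (lower q L)^[(k : ℕ)] f) := by
    refine le_antisymm (Submodule.span_le.2 ?_) (Submodule.span_mono ?_)
    · rintro _ ⟨k, rfl⟩
      rcases Nat.lt_or_ge d k with h | h
      · simp only [lower_iterate_eq_zero hq hf h]
        exact zero_mem _
      · exact Submodule.subset_span ⟨⟨k, Nat.lt_succ_iff.2 h⟩, rfl⟩
    · rintro _ ⟨k, rfl⟩
      exact ⟨k, rfl⟩
  rw [hspan, finrank_span_eq_card hli, Fintype.card_fin]

/-- Modulo the range of the lowering operator, the ladder of `f` is the line of `f`. -/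
theorem exists_of_mem_ladder {q : ℝ} {L : ℕ} {f g : Wave L} (hg : g ∈ ladder q f) :
    ∃ (a : ℂ) (h : Wave L), g = a • f + lower q L h := by
  refine Submodule.span_induction
    (p := fun g _ => ∃ (a : ℂ) (h : Wave L), g = a • f + lower q L h) ?_ ?_ ?_ ?_ hg
  · rintro _ ⟨k, rfl⟩
    cases k with
    | zero => exact ⟨1, 0, by simp⟩
    | succ k => exact ⟨0, (lower q L)^[k] f, by simp [Function.iterate_succ_apply']⟩
  · exact ⟨0, 0, by simp⟩
  · rintro x y _ _ ⟨a, h, rfl⟩ ⟨b, k, rfl⟩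
    refine ⟨a + b, h + k, ?_⟩
    rw [map_add]
    module
  · rintro c x _ ⟨a, h, rfl⟩
    refine ⟨c * a, c • h, ?_⟩
    rw [map_smul]
    module

/-- The representation generated by a highest weight vector is irreducible: by orthogonality to the
range of the lowering operator, it has no other highest weight vectors. -/
theorem ladder_le_of_isStable {q : ℝ} (hq : 0 < q) {L : ℕ} {d : ℤ} {f : Wave L}
    (hf : f ∈ highest q L d) {U : Submodule ℂ (Wave L)} (hU : IsStable q U) (hU0 : U ≠ ⊥)
    (hUf : U ≤ ladder q f) : ladder q f ≤ U := by
  obtain ⟨m, g, hg, hg0, hgm⟩ := exists_mem_highest hq (fun f hf => (hU f hf).1)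
    (fun f hf => (hU f hf).2.1) hU0
  obtain ⟨a, h, hgh⟩ := exists_of_mem_ladder (hUf hg)
  obtain rfl : m = d := by
    by_contra hm
    refine hg0 (inner_self_eq_zero_iff.1 ?_)
    nth_rewrite 2 [hgh]
    rw [dotProduct_add, dotProduct_smul, inner_lower_of_mem_highest hq hgm,
      inner_eq_zero_of_weight_ne hgm.2 hf.2 hm, smul_zero, add_zero]
  have hsub : g - a • f = 0 := by
    rw [← inner_self_eq_zero_iff]
    nth_rewrite 2 [hgh]
    rw [add_sub_cancel_left]
    exact inner_lower_of_mem_highest hq (Submodule.sub_mem _ hgm (Submodule.smul_mem _ _ hf)) h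
  rw [sub_eq_zero] at hsub
  have ha : a ≠ 0 := by
    rintro rfl
    exact hg0 (by rw [hsub, zero_smul])
  refine ladder_le ?_ fun x hx => (hU x hx).2.2
  have := Submodule.smul_mem U a⁻¹ hg
  rwa [hsub, smul_smul, inv_mul_cancel₀ ha, one_smul] at this

/-- The sum of the representations generated by the highest weight vectors of weight `d / 2`. -/
def isotypic (q : ℝ) (L : ℕ) (d : ℤ) : Submodule ℂ (Wave L) :=
  Submodule.span ℂ {f | ∃ g ∈ highest q L d, ∃ k : ℕ, f = (lower q L)^[k] g}

theorem ladder_le_isotypic {q : ℝ} {L : ℕ} {d : ℤ} {f : Wave L} (hf : f ∈ highest q L d) :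
    ladder q f ≤ isotypic q L d := by
  refine Submodule.span_mono ?_
  rintro _ ⟨k, rfl⟩
  exact ⟨f, hf, k, rfl⟩

theorem isotypic_isStable {q : ℝ} (hq : 0 < q) {L : ℕ} {d : ℤ} : IsStable q (isotypic q L d) := by
  refine isStable_span ?_
  rintro _ ⟨g, hg, k, rfl⟩
  have h := lower_iterate_stable hq hg k
  have hle := ladder_le_isotypic hg
  exact ⟨hle h.1, hle h.2.1, hle h.2.2⟩

theorem ham_mem_isotypic {Δ : ℝ} (hΔ : 1 ≤ Δ) {L : ℕ} {d : ℤ} {f : Wave L}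
    (hf : f ∈ isotypic (qParam Δ) L d) : ham Δ L f ∈ isotypic (qParam Δ) L d := by
  refine (Submodule.span_le (p := (isotypic (qParam Δ) L d).comap (ham Δ L))).2 ?_ hf
  rintro _ ⟨g, hg, k, rfl⟩
  have h : Function.Commute (ham Δ L) (lower (qParam Δ) L) := fun f => (lower_ham hΔ f).symm
  exact Submodule.subset_span ⟨_, ham_mem_highest hΔ hg, k, (h.iterate_right k).eq g⟩

theorem eq_of_mem_isotypic {q : ℝ} (hq : 0 < q) {L : ℕ} {d m : ℤ} {f : Wave L}
    (hf : f ∈ isotypic q L d) (hfm : f ∈ highest q L m) (hf0 : f ≠ 0) : m = d := by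
  by_contra hm
  refine hf0 (inner_self_eq_zero_iff.1 ?_)
  refine Submodule.span_induction (p := fun g _ => star f ⬝ᵥ g = 0) ?_ ?_ ?_ ?_ hf
  · rintro _ ⟨g, hg, k, rfl⟩
    cases k with
    | zero => exact inner_eq_zero_of_weight_ne hfm.2 hg.2 hm
    | succ k =>
      rw [Function.iterate_succ_apply']
      exact inner_lower_of_mem_highest hq hfm _
  · exact dotProduct_zero _
  · intro x y _ _ hx hy
    rw [dotProduct_add, hx, hy, add_zero]
  · intro c x _ hx
    rw [dotProduct_smul, hx, smul_zero]

/-- The lowest eigenvalue of the Hamiltonian on an isotypic component is attained at a highest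
weight vector, since the eigenspaces are subrepresentations. -/
theorem IsGround.isotypic {Δ : ℝ} (hΔ : 1 ≤ Δ) {L : ℕ} {d : ℤ} {t : ℝ}
    (ht : IsGround (ham Δ L) (highest (qParam Δ) L d) t) :
    IsGround (ham Δ L) (isotypic (qParam Δ) L d) t := by
  have hq := (qParam_spec hΔ).1
  obtain ⟨f, hf, hf0, hft⟩ := ht.1
  have hfi := ladder_le_isotypic hf (self_mem_ladder (q := qParam Δ) f)
  refine ⟨⟨f, hfi, hf0, hft⟩, ?_⟩
  obtain ⟨s, ⟨g, hg, hg0, hgs⟩, hs⟩ := exists_isGround (ham_symm hΔ)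
    (fun f => ham_mem_isotypic hΔ) ((Submodule.ne_bot_iff _).2 ⟨f, hfi, hf0⟩)
  let A : Submodule ℂ (Wave L) :=
    XXZ.isotypic (qParam Δ) L d ⊓ LinearMap.ker (ham Δ L - (s : ℂ) • LinearMap.id)
  have hA {x : Wave L} : x ∈ A ↔ x ∈ XXZ.isotypic (qParam Δ) L d ∧ ham Δ L x = (s : ℂ) • x := by
    simp [A, sub_eq_zero]
  obtain ⟨m, x, hx, hx0, hxm⟩ := exists_mem_highest hq (V := A)
    (fun x hx => hA.2 ⟨(isotypic_isStable hq x (hA.1 hx).1).1, by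
      rw [← spinZ_ham hΔ, (hA.1 hx).2, map_smul]⟩)
    (fun x hx => hA.2 ⟨(isotypic_isStable hq x (hA.1 hx).1).2.1, by
      rw [← raise_ham hΔ, (hA.1 hx).2, map_smul]⟩)
    ((Submodule.ne_bot_iff _).2 ⟨g, hA.2 ⟨hg, hgs⟩, hg0⟩)
  obtain rfl := eq_of_mem_isotypic hq (hA.1 hx).1 hxm hx0
  have hts := ht.le hxm hx0 (hA.1 hx).2
  exact fun f hf => (mul_le_mul_of_nonneg_right hts (inner_self_nonneg f)).trans (hs f hf)

/-! ### The sectors of fixed total spin -/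

/-- The identification of the Hilbert space with the space of wave functions. -/
def toWave (L : ℕ) : State L ≃ₗ[ℂ] Wave L := WithLp.linearEquiv 2 ℂ _

theorem toWave_apply {L : ℕ} (M : Op L) (ψ : State L) :
    toWave L (Matrix.toEuclideanLin M ψ) = M *ᵥ toWave L ψ := rfl

theorem inner_eq_toWave {L : ℕ} (x y : State L) :
    inner ℂ x y = star (toWave L x) ⬝ᵥ toWave L y := by
  rw [EuclideanSpace.inner_eq_star_dotProduct, dotProduct_comm]
  rfl

theorem isInvariant_comap {q : ℝ} {L : ℕ} {V : Submodule ℂ (Wave L)} :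
    IsInvariant q (V.comap (toWave L).toLinearMap) ↔ IsStable q V := by
  constructor
  · intro h f hf
    have := h ((toWave L).symm f) (by simpa using hf)
    simp only [Submodule.mem_comap, LinearEquiv.coe_coe, toWave_apply,
      LinearEquiv.apply_symm_apply] at this
    exact this
  · intro h ψ hψ
    exact h _ hψ

theorem comap_map_toWave {L : ℕ} (W : Submodule ℂ (State L)) :
    (W.map (toWave L).toLinearMap).comap (toWave L).toLinearMap = W :=
  Submodule.comap_map_eq_of_injective (toWave L).injective W

theorem isIrreducibleRep_ladder {q : ℝ} (hq : 0 < q) {L : ℕ} {d : ℤ} {f : Wave L}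
    (hf : f ∈ highest q L d) (hf0 : f ≠ 0) :
    IsIrreducibleRep q ((ladder q f).comap (toWave L).toLinearMap) := by
  refine ⟨isInvariant_comap.2 (ladder_isStable hq hf), ?_, fun V hV hle => ?_⟩
  · refine (Submodule.ne_bot_iff _).2 ⟨(toWave L).symm f, ?_, by simpa using hf0⟩
    simpa using self_mem_ladder f
  · rw [← comap_map_toWave V] at hV hle ⊢
    set U := V.map (toWave L).toLinearMap
    have hle' : U ≤ ladder q f := fun x hx => by
      have := @hle ((toWave L).symm x) (by simpa using hx)
      simpa using this
    by_cases hU0 : U = ⊥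
    · left
      rw [hU0]
      exact (Submodule.eq_bot_iff _).2 fun x hx => by simpa using hx
    · right
      rw [le_antisymm hle' (ladder_le_of_isStable hq hf (isInvariant_comap.1 hV) hU0 hle')]

theorem finrank_comap_toWave {L : ℕ} (V : Submodule ℂ (Wave L)) :
    Module.finrank ℂ (V.comap (toWave L).toLinearMap) = Module.finrank ℂ V :=
  ((toWave L).submoduleMap _).finrank_eq.trans (by
    rw [Submodule.map_comap_eq_of_surjective (toWave L).surjective])

theorem mem_spinSector {q : ℝ} (hq : 0 < q) {L d n : ℕ} (hL : L = d + 2 * n) {f : Wave L}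
    (hf : f ∈ highest q L d) (hf0 : f ≠ 0) : (toWave L).symm f ∈ spinSector q L n := by
  have hle : (ladder q f).comap (toWave L).toLinearMap ≤ spinSector q L n := by
    refine le_sSup ⟨isIrreducibleRep_ladder hq hf hf0, ?_⟩
    rw [finrank_comap_toWave, finrank_ladder hq hf hf0]
    omega
  refine hle ?_
  simpa using self_mem_ladder f

/-- Every irreducible representation of dimension `d + 1` is generated by a highest weight vector of
weight `d / 2`. -/
theorem spinSector_le {q : ℝ} (hq : 0 < q) {L d n : ℕ} (hL : L = d + 2 * n) :
    spinSector q L n ≤ (isotypic q L d).comap (toWave L).toLinearMap := by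
  refine sSup_le ?_
  rintro W ⟨⟨hW, hW0, hmin⟩, hdim⟩
  rw [← comap_map_toWave W] at hW hW0 hmin hdim ⊢
  set V := W.map (toWave L).toLinearMap
  have hV := isInvariant_comap.1 hW
  have hV0 : V ≠ ⊥ := by
    intro h
    rw [h] at hW0
    exact hW0 ((Submodule.eq_bot_iff _).2 fun x hx => by simpa using hx)
  obtain ⟨m, f, hf, hf0, hfm⟩ := exists_mem_highest hq (fun f hf => (hV f hf).1)
    (fun f hf => (hV f hf).2.1) hV0
  have hm : 0 ≤ m := by
    by_contra! h
    rw [highest_of_neg hq h] at hfm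
    exact hf0 hfm
  lift m to ℕ using hm
  have hle : (ladder q f).comap (toWave L).toLinearMap ≤ V.comap (toWave L).toLinearMap :=
    Submodule.comap_mono (ladder_le hf fun g hg => (hV g hg).2.2)
  obtain ⟨h1, h2, -⟩ := isIrreducibleRep_ladder hq hfm hf0
  have heq := (hmin _ h1 hle).resolve_left h2
  rw [← heq, finrank_comap_toWave, finrank_ladder hq hfm hf0] at hdim
  obtain rfl : m = d := by omega
  rw [← heq]
  exact Submodule.comap_mono (ladder_le_isotypic hfm)

theorem isLeast_energySet {Δ : ℝ} (hΔ : 1 ≤ Δ) {L d n : ℕ} (hL : L = d + 2 * n) {t : ℝ}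
    (ht : IsGround (ham Δ L) (highest (qParam Δ) L d) t) : IsLeast (energySet Δ L n) t := by
  have hq := (qParam_spec hΔ).1
  constructor
  · obtain ⟨f, hf, hf0, hft⟩ := ht.1
    set x := (toWave L).symm f with hx
    have hx0 : x ≠ 0 := by simpa [hx] using hf0
    have hxt : Matrix.toEuclideanLin (hamiltonian Δ L) x = (t : ℂ) • x := by
      apply (toWave L).injective
      rw [toWave_apply, map_smul, hx, LinearEquiv.apply_symm_apply]
      exact hft
    have hn : ‖((‖x‖⁻¹ : ℂ)) • x‖ = 1 := norm_smul_inv_norm hx0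
    refine ⟨((‖x‖⁻¹ : ℂ)) • x, Submodule.smul_mem _ _ (mem_spinSector hq hL hf hf0), hn, ?_⟩
    rw [map_smul, hxt, smul_comm, inner_smul_right, inner_self_eq_norm_sq_to_K, hn]
    simp
  · rintro e ⟨ψ, hψ, hn, he⟩
    have h1 := (ht.isotypic hΔ).2 _ (spinSector_le hq hL hψ)
    have h2 : star (toWave L ψ) ⬝ᵥ toWave L ψ = 1 := by
      rw [← inner_eq_toWave, inner_self_eq_norm_sq_to_K, hn]
      simp
    have h3 : star (toWave L ψ) ⬝ᵥ ham Δ L (toWave L ψ) = e := by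
      rw [← he, inner_eq_toWave]
      rfl
    change t * (star (toWave L ψ) ⬝ᵥ toWave L ψ).re ≤
      (star (toWave L ψ) ⬝ᵥ ham Δ L (toWave L ψ)).re at h1
    rw [h2, h3] at h1
    simpa using h1

theorem isLeast_and_isGround_minEnergy {Δ : ℝ} (hΔ : 1 ≤ Δ) {L d n : ℕ} (hL : L = d + 2 * n) :
    IsLeast (energySet Δ L n) (minEnergy Δ L n) ∧
      IsGround (ham Δ L) (highest (qParam Δ) L d) (minEnergy Δ L n) := by
  obtain ⟨t, ht⟩ := exists_isGround_highest hΔ n hL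
  have h := isLeast_energySet hΔ hL ht
  have he : minEnergy Δ L n = t := h.csInf_eq
  rw [he]
  exact ⟨h, ht⟩

theorem minEnergy_lt_succ {Δ : ℝ} (hΔ : 1 ≤ Δ) {L n : ℕ} (hn : n + 1 ≤ L / 2) :
    minEnergy Δ L n < minEnergy Δ L (n + 1) := by
  obtain ⟨d, rfl⟩ : ∃ d, L = d + 2 * n + 2 := ⟨L - 2 * n - 2, by omega⟩
  exact ground_lt hΔ (d + 2 * n) rfl (isLeast_and_isGround_minEnergy hΔ (by omega)).2
    (isLeast_and_isGround_minEnergy hΔ (by omega)).2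

end XXZ

end

theorem theorem1p3 (L : ℕ) (hL : 2 ≤ L) (Δ : ℝ) (hΔ : 1 ≤ Δ) :
    (∀ n : ℕ, n ≤ L / 2 → IsLeast (XXZ.energySet Δ L n) (XXZ.minEnergy Δ L n)) ∧
      ∀ m n : ℕ, m < n → n ≤ L / 2 → XXZ.minEnergy Δ L m < XXZ.minEnergy Δ L n := by
  refine ⟨fun n hn => (XXZ.isLeast_and_isGround_minEnergy hΔ (d := L - 2 * n) (by omega)).1,
    fun m n hmn hn => ?_⟩
  induction n, hmn using Nat.le_induction with
  | base => exact XXZ.minEnergy_lt_succ hΔ hn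
  | succ n hmn ih => exact (ih (by omega)).trans (XXZ.minEnergy_lt_succ hΔ hn)
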